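/- Let $\mathbb F$ be a field, $G$ a finite group, and $G_*$ the set of conjugacy classes of $G$. For $n\ge 0$ let $\overline G_n$ be the monoid, under matrix multiplication with $g0=0g=0$ and $g+0=0+g=g$, of $n\times n$ matrices with entries in $G\cup\{0\}$ having at most one nonzero entry in each row and each column; it contains the wreath product $G_n=G^n\rtimes S_n$, where $(g,\sigma)$ is the matrix whose only nonzero entry in the $j$-th column is $g_{\sigma(j)}$, in position $(\sigma(j),j)$. Let $\varepsilon_i\in\overline G_n$ be the identity matrix with its $i$-th diagonal entry replaced by $0$. The degree of $\gamma\in\overline G_n$ is the number of $k$ with $\gamma_{kk}\ne 1$, and $(\mathbb F\overline G_n)^k$ is the span of the elements of degree at most $k$ in the semigroup algebra $\mathbb F\overline G_n$. Let $\overline{\mathcal Z}_{0,n}$ be the center of $\mathbb F\overline G_n$ and $\overline{\mathcal Z}_{0,n}^k=\overline{\mathcal Z}_{0,n}\cap(\mathbb F\overline G_n)^k$. Let $\theta_n:\mathbb F\overline G_n\to\mathbb F\overline G_{n-1}$ be the linear extension of the map sending a matrix to its upper left corner of order $n-1$. The commutative algebra $\overline{\mathcal Z}_0$ consists of all sequences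 $(\alpha_n)_{n\ge 0}$ with $\alpha_n\in\overline{\mathcal Z}_{0,n}$, $\theta_n(\alpha_n)=\alpha_{n-1}$ for $n\ge1$, and $\alpha_n\in(\mathbb F\overline G_n)^k$ for all $n$ for some $k$ independent of $n$, with componentwise operations; $\overline{\mathcal Z}_0^k$ is the subspace of the sequences with $\alpha_n\in(\mathbb F\overline G_n)^k$ for all $n$. Let $\mathcal P(G_*)$ be the set of families $\rho=(\rho(C))_{C\in G_*}$ of partitions, and $\|\rho\|=\sum_C|\rho(C)|$. For $T\subseteq\{1,\dots,n\}$ with $|T|=\|\rho\|$ let $C^\rho_{n,T}=\sum (g,\sigma)$, where the sum is over all ways of placing pairwise distinct indices $k^C_{s,1},\dots,k^C_{s,\mu}$ from $T$ in the cycles $(k^C_{s,1},\dots,k^C_{s,\mu})$, one cycle for each $C\in G_*$ and each part $\mu=\rho(C)_s$ of $\rho(C)$, and over all $g\in G^n$ with $g_j=1$ for $j\notin T$ such that each cycle-product $g_{k^C_{s,\mu}}\cdots g_{k^C_{s,1}}$ lies in $C$; here $\sigma$ is the product of the cycles, and an element $(g,\sigma)$ is counted as often as it arises. Let $\widetilde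 C^\rho_{n,T}$ be the sum of the distinct elements $(g,\sigma)$ that arise. Put $$\Delta_n^\rho=\sum_{|T|=\|\rho\|}C^\rho_{n,T}\prod_{i\in T}(1-\varepsilon_i),\qquad \widetilde\Delta_n^\rho=\sum_{|T|=\|\rho\|}\widetilde C^\rho_{n,T}\prod_{i\in T}(1-\varepsilon_i)$$ (so both are $0$ if $\|\rho\|>n$), and $\Delta^\rho=(\Delta^\rho_n)_{n\ge0}$, $\widetilde\Delta^\rho=(\widetilde\Delta^\rho_n)_{n\ge0}$. (a) If $\mathbb F$ has characteristic $0$, the $\Delta^\rho$, $\rho\in\mathcal P(G_*)$, lie in $\overline{\mathcal Z}_0$ and form a basis of it. For every $k\ge 0$ such that $k!\ne0$ in $\mathbb F$ (hence for every $k$ in characteristic $0$), the $\Delta^\rho$ with $\|\rho\|\le k$ form a basis of $\overline{\mathcal Z}_0^k$, and for every $n\ge k$ the $\Delta_n^\rho$ with $\|\rho\|\le k$ form a basis of $\overline{\mathcal Z}_{0,n}^k$. In particular, for every $n$ with $n!\neq 0$ in $\mathbb F$, the $\Delta_n^\rho$ with $\|\rho\|\le n$ form a basis of the center $\overline{\mathcal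 Z}_{0,n}$. (b) Over an arbitrary field $\mathbb F$ all these statements hold, for all $n\ge k\ge 0$, with $\widetilde\Delta^\rho$ and $\widetilde\Delta_n^\rho$ in place of $\Delta^\rho$ and $\Delta_n^\rho$. -/

import Mathlib

noncomputable section

namespace WreathLimit

open scoped Classical

set_option linter.unusedSectionVars false
set_option linter.unusedVariables false

/-! ### The semigroup of matrices over `G ∪ {0}` -/

/-- The underlying set of the semigroup `Ḡ_n`: the `n × n` matrices with entries in `G ∪ {0}` having
at most one nonzero entry in every row and in every column. -/
@[ext]
structure GBar (G : Type*) (n : ℕ) where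
  /-- the matrix -/
  entry : Matrix (Fin n) (Fin n) (WithZero G)
  row_unique : ∀ i j j', entry i j ≠ 0 → entry i j' ≠ 0 → j = j'
  col_unique : ∀ i i' j, entry i j ≠ 0 → entry i' j ≠ 0 → i = i'

section Semigroup

variable {G : Type*} [Group G] {n : ℕ}

namespace GBar

theorem eq_of_coe_iff {x y : WithZero G} (h : ∀ a : G, x = (a : WithZero G) ↔ y = (a : WithZero G)) :
    x = y := by
  induction x using WithZero.recZeroCoe with
  | zero =>
    induction y using WithZero.recZeroCoe with
    | zero => rfl
    | coe b => exact absurd ((h b).2 rfl) WithZero.zero_ne_coe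
  | coe a => exact ((h a).1 rfl).symm

/-- An entry of the matrix product, with the convention `g0 = 0g = 0`, `g + 0 = 0 + g = g`: at most
one of the summands `A i j * B j k` is nonzero; the entry is that summand if there is one, and `0`
otherwise. -/
def mulEntry (A B : GBar G n) : Matrix (Fin n) (Fin n) (WithZero G) := fun i k =>
  if h : ∃ j, A.entry i j * B.entry j k ≠ 0 then A.entry i h.choose * B.entry h.choose k else 0

theorem mulEntry_eq_coe (A B : GBar G n) (i k : Fin n) (a : G) :
    mulEntry A B i k = a ↔ ∃ j, A.entry i j * B.entry j k = a := by
  unfold mulEntry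
  constructor
  · intro h
    split_ifs at h with h'
    · exact ⟨_, h⟩
    · exact absurd h WithZero.zero_ne_coe
  · rintro ⟨j, hj⟩
    have hne : A.entry i j * B.entry j k ≠ 0 := by rw [hj]; exact WithZero.coe_ne_zero
    have h' : ∃ j, A.entry i j * B.entry j k ≠ 0 := ⟨j, hne⟩
    rw [dif_pos h']
    have : h'.choose = j :=
      A.row_unique i _ _ (left_ne_zero_of_mul h'.choose_spec) (left_ne_zero_of_mul hne)
    rw [this, hj]

theorem exists_of_mulEntry_ne_zero {A B : GBar G n} {i k : Fin n} (h : mulEntry A B i k ≠ 0) :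
    ∃ j, A.entry i j ≠ 0 ∧ B.entry j k ≠ 0 := by
  unfold mulEntry at h
  split_ifs at h with h'
  · exact ⟨_, left_ne_zero_of_mul h, right_ne_zero_of_mul h⟩
  · exact absurd rfl h

/-- Matrix multiplication. -/
instance : Mul (GBar G n) where
  mul A B :=
    { entry := mulEntry A B
      row_unique := by
        intro i j j' h h'
        obtain ⟨l, h1, h2⟩ := exists_of_mulEntry_ne_zero h
        obtain ⟨l', h1', h2'⟩ := exists_of_mulEntry_ne_zero h'
        obtain rfl := A.row_unique _ _ _ h1 h1'
        exact B.row_unique _ _ _ h2 h2'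
      col_unique := by
        intro i i' j h h'
        obtain ⟨l, h1, h2⟩ := exists_of_mulEntry_ne_zero h
        obtain ⟨l', h1', h2'⟩ := exists_of_mulEntry_ne_zero h'
        obtain rfl := B.col_unique _ _ _ h2 h2'
        exact A.col_unique _ _ _ h1 h1' }

theorem mul_entry_eq_coe (A B : GBar G n) (i k : Fin n) (a : G) :
    (A * B).entry i k = a ↔ ∃ j, A.entry i j * B.entry j k = a :=
  mulEntry_eq_coe A B i k a

theorem mul_eq_coe {x y : WithZero G} {a : G} :
    x * y = a ↔ ∃ b c : G, x = b ∧ y = c ∧ b * c = a := by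
  constructor
  · intro h
    have hne : x * y ≠ 0 := by rw [h]; exact WithZero.coe_ne_zero
    obtain ⟨b, rfl⟩ := WithZero.ne_zero_iff_exists.1 (left_ne_zero_of_mul hne)
    obtain ⟨c, rfl⟩ := WithZero.ne_zero_iff_exists.1 (right_ne_zero_of_mul hne)
    exact ⟨b, c, rfl, rfl, by exact_mod_cast h⟩
  · rintro ⟨b, c, rfl, rfl, rfl⟩
    simp

theorem ext_coe {A B : GBar G n}
    (h : ∀ i j, ∀ a : G, A.entry i j = (a : WithZero G) ↔ B.entry i j = (a : WithZero G)) :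
    A = B := by
  apply GBar.ext
  funext i j
  exact eq_of_coe_iff (h i j)

/-- The identity matrix. -/
instance : One (GBar G n) where
  one :=
    { entry := fun i j => if i = j then 1 else 0
      row_unique := by intro i j j' h h'; simp_all
      col_unique := by intro i i' j h h'; simp_all }

theorem one_entry (i j : Fin n) : (1 : GBar G n).entry i j = if i = j then 1 else 0 := rfl

instance : Monoid (GBar G n) where
  mul_assoc A B C := by
    apply ext_coe
    intro i l a
    simp only [mul_entry_eq_coe, mul_eq_coe]
    constructor
    · rintro ⟨k, _, c, ⟨j, p, q, hp, hq, rfl⟩, hc, rfl⟩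
      exact ⟨j, p, q * c, hp, ⟨k, q, c, hq, hc, rfl⟩, (mul_assoc _ _ _).symm⟩
    · rintro ⟨j, p, _, hp, ⟨k, q, c, hq, hc, rfl⟩, rfl⟩
      exact ⟨k, p * q, c, ⟨j, p, q, hp, hq, rfl⟩, hc, mul_assoc _ _ _⟩
  one_mul A := by
    apply ext_coe
    intro i l a
    simp only [mul_entry_eq_coe, one_entry, ite_mul, one_mul, zero_mul]
    constructor
    · rintro ⟨j, hj⟩
      split_ifs at hj with h
      · rw [h, hj]
      · exact absurd hj WithZero.zero_ne_coe
    · intro h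
      exact ⟨i, by simpa using h⟩
  mul_one A := by
    apply ext_coe
    intro i l a
    simp only [mul_entry_eq_coe, one_entry, mul_ite, mul_one, mul_zero]
    constructor
    · rintro ⟨j, hj⟩
      split_ifs at hj with h
      · rw [← h, hj]
      · exact absurd hj WithZero.zero_ne_coe
    · intro h
      exact ⟨l, by simpa using h⟩

/-- The degree of a matrix: the number of `k` such that the `k`-th diagonal entry is not `1`. -/
def deg (γ : GBar G n) : ℕ := (Finset.univ.filter fun k => γ.entry k k ≠ 1).card

theorem deg_mul_le (A B : GBar G n) : (A * B).deg ≤ A.deg + B.deg := by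
  unfold deg
  refine le_trans (Finset.card_le_card ?_) (Finset.card_union_le _ _)
  intro k
  simp only [Finset.mem_filter, Finset.mem_univ, true_and, Finset.mem_union]
  intro h
  by_contra! hc
  apply h
  have := (mul_entry_eq_coe A B k k 1).2 ⟨k, by rw [hc.1, hc.2]; simp⟩
  simpa using this

theorem deg_one : (1 : GBar G n).deg = 0 := by
  simp [deg, one_entry]

/-- The canonical projection `Ḡ_{n+1} → Ḡ_n` onto the upper left corner of order `n`. -/
def corner (γ : GBar G (n + 1)) : GBar G n where
  entry i j := γ.entry i.castSucc j.castSucc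
  row_unique i j j' h h' := Fin.castSucc_injective _ (γ.row_unique _ _ _ h h')
  col_unique i i' j h h' := Fin.castSucc_injective _ (γ.col_unique _ _ _ h h')

/-- The diagonal idempotent `ε_i`: the `(i,i)` entry is `0`, the other diagonal entries are `1`. -/
def eps (i : Fin n) : GBar G n where
  entry a b := if a = b ∧ a ≠ i then 1 else 0
  row_unique a b b' h h' := by simp_all
  col_unique a a' b h h' := by simp_all

theorem eps_entry (i a b : Fin n) :
    (eps i : GBar G n).entry a b = if a = b ∧ a ≠ i then 1 else 0 := rfl

theorem eps_mul_entry (i : Fin n) (A : GBar G n) (a b : Fin n) :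
    (eps i * A).entry a b = if a = i then 0 else A.entry a b := by
  apply eq_of_coe_iff
  intro x
  rw [mul_entry_eq_coe]
  by_cases h : a = i
  · simp [eps_entry, h]
  · simp only [eps_entry, h, ne_eq, not_false_eq_true, and_true, if_false]
    constructor
    · rintro ⟨j, hj⟩
      by_cases hh : a = j
      · subst hh; simpa using hj
      · simp [hh] at hj
    · intro hx
      exact ⟨a, by simpa using hx⟩

theorem mul_eps_entry (i : Fin n) (A : GBar G n) (a b : Fin n) :
    (A * eps i).entry a b = if b = i then 0 else A.entry a b := by
  apply eq_of_coe_iff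
  intro x
  rw [mul_entry_eq_coe]
  by_cases h : b = i
  · subst h
    simp only [eps_entry, if_true]
    constructor
    · rintro ⟨j, hj⟩
      have : ¬ (j = b ∧ j ≠ b) := fun h => h.2 h.1
      simp [this] at hj
    · intro h
      exact absurd h WithZero.zero_ne_coe
  · simp only [eps_entry, h, if_false]
    constructor
    · rintro ⟨j, hj⟩
      by_cases hh : j = b
      · subst hh; simpa [h] using hj
      · simp [hh] at hj
    · intro hx
      exact ⟨b, by simpa [h] using hx⟩

theorem eps_commute (i j : Fin n) : Commute (eps i : GBar G n) (eps j) := by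
  apply GBar.ext
  funext a b
  rw [eps_mul_entry, mul_eps_entry]
  simp only [eps_entry]
  by_cases h : a = b
  · subst h; rfl
  · simp [h]

theorem eps_mul_self (i : Fin n) : (eps i * eps i : GBar G n) = eps i := by
  apply GBar.ext
  funext a b
  rw [eps_mul_entry]
  by_cases h : a = i <;> simp [eps_entry, h]

/-- The inclusion of `Ḡ_n` in `Ḡ_{n+1}` as the matrices whose last row and column are zero. -/
def zeroExt : GBar G n →ₙ* GBar G (n + 1) where
  toFun γ :=
    { entry := fun i j => Fin.lastCases (motive := fun _ => WithZero G) 0 (fun i' =>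
        Fin.lastCases (motive := fun _ => WithZero G) 0 (fun j' => γ.entry i' j') j) i
      row_unique := by
        intro i j j'
        cases i using Fin.lastCases <;> cases j using Fin.lastCases <;>
          cases j' using Fin.lastCases <;> simp
        exact γ.row_unique _ _ _
      col_unique := by
        intro i i' j
        cases i using Fin.lastCases <;> cases i' using Fin.lastCases <;>
          cases j using Fin.lastCases <;> simp
        exact γ.col_unique _ _ _ }
  map_mul' A B := by
    apply ext_coe
    intro i k a
    rw [mul_entry_eq_coe]
    cases i using Fin.lastCases with
    | last => simp
    | cast i =>
      cases k using Fin.lastCases with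
      | last => simp [Fin.exists_fin_succ']
      | cast k => simp [Fin.exists_fin_succ', mul_entry_eq_coe]

theorem zeroExt_injective : Function.Injective (zeroExt : GBar G n → GBar G (n + 1)) := by
  intro A B h
  apply GBar.ext
  funext i j
  have := congrArg (fun C : GBar G (n + 1) => C.entry i.castSucc j.castSucc) h
  simpa [zeroExt] using this

theorem zeroExt_corner (γ : GBar G (n + 1)) :
    zeroExt (corner γ) = eps (Fin.last n) * γ * eps (Fin.last n) := by
  apply GBar.ext
  funext i j
  rw [mul_eps_entry, eps_mul_entry]
  cases i using Fin.lastCases <;> cases j using Fin.lastCases <;>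
    simp [zeroExt, corner, Fin.castSucc_ne_last]

theorem corner_one : corner (1 : GBar G (n + 1)) = 1 := by
  apply GBar.ext
  funext i j
  simp [corner, one_entry]

/-- The element `(g, σ)` of the wreath product `G_n`, as the matrix `Δ(g) M(σ)`: its only nonzero
entry in row `i` is `g i`, in the column `j` with `σ j = i`. -/
def ofWreath (g : Fin n → G) (σ : Equiv.Perm (Fin n)) : GBar G n where
  entry i j := if σ j = i then (g i : WithZero G) else 0
  row_unique i j j' h h' := by
    have h1 : σ j = i := by by_contra hc; simp [hc] at h
    have h2 : σ j' = i := by by_contra hc; simp [hc] at h'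
    exact σ.injective (h1.trans h2.symm)
  col_unique i i' j h h' := by
    have h1 : σ j = i := by by_contra hc; simp [hc] at h
    have h2 : σ j = i' := by by_contra hc; simp [hc] at h'
    exact h1.symm.trans h2

end GBar

end Semigroup

open GBar

/-! ### Semigroup algebras, the filtration by degree, centers, and the limit algebra -/

variable (F : Type*) [Field F] (G : Type*) [Group G] {n : ℕ}

/-- The `k`-th term of the filtration of `F Ḡ_n`: the span of the elements of degree at most `k`. -/
def degFilt (n k : ℕ) : Submodule F (MonoidAlgebra F (GBar G n)) :=
  Submodule.span F {x | ∃ γ : GBar G n, γ.deg ≤ k ∧ x = MonoidAlgebra.single γ 1}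

/-- The `k`-th term of the induced filtration on the center of `F Ḡ_n`. -/
def centerFilt (n k : ℕ) : Submodule F (MonoidAlgebra F (GBar G n)) :=
  Subalgebra.toSubmodule (Subalgebra.center F (MonoidAlgebra F (GBar G n))) ⊓ degFilt F G n k

/-- The linear extension `F Ḡ_{n+1} → F Ḡ_n` of the canonical projection (not multiplicative). -/
def theta (n : ℕ) : MonoidAlgebra F (GBar G (n + 1)) →ₗ[F] MonoidAlgebra F (GBar G n) :=
  MonoidAlgebra.mapDomainLinearMap F F corner

theorem degFilt_mul {n k l : ℕ} {x y : MonoidAlgebra F (GBar G n)} (hx : x ∈ degFilt F G n k)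
    (hy : y ∈ degFilt F G n l) : x * y ∈ degFilt F G n (k + l) := by
  have h := Submodule.mul_mem_mul hx hy
  rw [degFilt, degFilt, Submodule.span_mul_span] at h
  refine Submodule.span_mono ?_ h
  rintro _ ⟨_, ⟨a, ha, rfl⟩, _, ⟨b, hb, rfl⟩, rfl⟩
  exact ⟨a * b, (deg_mul_le a b).trans (add_le_add ha hb), by simp [MonoidAlgebra.single_mul_single]⟩

theorem degFilt_mono {n k l : ℕ} (h : k ≤ l) : degFilt F G n k ≤ degFilt F G n l :=
  Submodule.span_mono fun _ ⟨γ, hγ, e⟩ => ⟨γ, hγ.trans h, e⟩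

theorem algebraMap_mem_degFilt (n : ℕ) (r : F) :
    algebraMap F (MonoidAlgebra F (GBar G n)) r ∈ degFilt F G n 0 := by
  rw [Algebra.algebraMap_eq_smul_one]
  exact Submodule.smul_mem _ _ (Submodule.subset_span ⟨1, deg_one.le, rfl⟩)

theorem theta_algebraMap (n : ℕ) (r : F) : theta F G n (algebraMap F _ r) = algebraMap F _ r := by
  rw [Algebra.algebraMap_eq_smul_one, Algebra.algebraMap_eq_smul_one, map_smul]
  congr 1
  simp [theta, MonoidAlgebra.one_def, corner_one]

theorem zeroExt_theta (n : ℕ) (x : MonoidAlgebra F (GBar G (n + 1))) :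
    MonoidAlgebra.mapDomainNonUnitalRingHom F zeroExt (theta F G n x) =
      MonoidAlgebra.single (eps (Fin.last n)) 1 * x * MonoidAlgebra.single (eps (Fin.last n)) 1 := by
  induction x using MonoidAlgebra.induction_linear with
  | zero => simp
  | add x y hx hy => simp only [map_add, mul_add, add_mul, hx, hy]
  | single γ r =>
    change MonoidAlgebra.mapDomain zeroExt (MonoidAlgebra.mapDomainLinearMap F F corner _) = _
    simp [MonoidAlgebra.single_mul_single, zeroExt_corner]

theorem theta_mul {n : ℕ} {x y : MonoidAlgebra F (GBar G (n + 1))}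
    (hx : x ∈ Subalgebra.center F (MonoidAlgebra F (GBar G (n + 1)))) :
    theta F G n (x * y) = theta F G n x * theta F G n y := by
  have hinj : Function.Injective
      (MonoidAlgebra.mapDomainNonUnitalRingHom F (zeroExt : GBar G n →ₙ* GBar G (n + 1))) :=
    MonoidAlgebra.mapDomain_injective zeroExt_injective
  apply hinj
  rw [map_mul (MonoidAlgebra.mapDomainNonUnitalRingHom F zeroExt), zeroExt_theta, zeroExt_theta,
    zeroExt_theta]
  set e : MonoidAlgebra F (GBar G (n + 1)) := MonoidAlgebra.single (eps (Fin.last n)) 1 with he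
  have hee : e * e = e := by
    rw [he, MonoidAlgebra.single_mul_single, eps_mul_self, one_mul]
  have hc : e * x = x * e := Subalgebra.mem_center_iff.1 hx e
  calc e * (x * y) * e = (e * x) * (y * e) := by noncomm_ring
    _ = x * (e * e * e) * (y * e) := by rw [hee, hee, hc]
    _ = (x * e) * e * (e * y * e) := by noncomm_ring
    _ = e * x * e * (e * y * e) := by rw [hc]

/-- The limit algebra `Z̄_0`: the sequences `(α_n)_{n ≥ 0}` of elements `α_n` of the center of
`F Ḡ_n` which are compatible with the projections and have bounded degree, with componentwise
operations. -/
def limitAlgebra : Subalgebra F (∀ n : ℕ, MonoidAlgebra F (GBar G n)) where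
  carrier := {α | (∀ n, α n ∈ Subalgebra.center F (MonoidAlgebra F (GBar G n))) ∧
    (∀ n, theta F G n (α (n + 1)) = α n) ∧ ∃ k, ∀ n, α n ∈ degFilt F G n k}
  mul_mem' := by
    rintro α β ⟨hα, hα', k, hk⟩ ⟨hβ, hβ', l, hl⟩
    refine ⟨fun n => mul_mem (hα n) (hβ n), fun n => ?_, k + l, fun n => ?_⟩
    · rw [Pi.mul_apply, theta_mul F G (hα _), hα', hβ', Pi.mul_apply]
    · exact degFilt_mul F G (hk n) (hl n)
  add_mem' := by
    rintro α β ⟨hα, hα', k, hk⟩ ⟨hβ, hβ', l, hl⟩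
    refine ⟨fun n => add_mem (hα n) (hβ n), fun n => ?_, max k l, fun n => ?_⟩
    · rw [Pi.add_apply, map_add, hα', hβ', Pi.add_apply]
    · exact add_mem (degFilt_mono F G (le_max_left _ _) (hk n))
        (degFilt_mono F G (le_max_right _ _) (hl n))
  algebraMap_mem' r :=
    ⟨fun n => Subalgebra.algebraMap_mem _ r, fun n => theta_algebraMap F G n r, 0,
      fun n => algebraMap_mem_degFilt F G n r⟩

theorem limitAlgebra_mul_comm (α β : limitAlgebra F G) : α * β = β * α := by
  apply Subtype.ext
  funext n
  exact (Subalgebra.mem_center_iff.1 (α.2.1 n) (β.1 n)).symm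

/-- The `k`-th term `Z̄_0^k` of the filtered algebra `Z̄_0`: the sequences all of whose components
have degree at most `k`. -/
def limitFilt (k : ℕ) : Submodule F (limitAlgebra F G) where
  carrier := {α | ∀ n, α.1 n ∈ degFilt F G n k}
  add_mem' h h' n := add_mem (h n) (h' n)
  zero_mem' n := zero_mem _
  smul_mem' r _ h n := Submodule.smul_mem _ r (h n)

/-! ### Partition-valued functions and the elements `Δ` -/

/-- Partition-valued functions on the set of conjugacy classes of `G`. -/
abbrev PartFun (G : Type*) [Group G] := ConjClasses G → Σ m : ℕ, m.Partition

variable {G} [Fintype G]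

/-- `‖ρ‖`, the sum of the sizes of all partitions `ρ(C)`. -/
def size (ρ : PartFun G) : ℕ := ∑ C, (ρ C).1

/-- The parts of `ρ(C)`, in decreasing order. -/
def parts (ρ : PartFun G) (C : ConjClasses G) : List ℕ := (ρ C).2.parts.sort (· ≥ ·)

/-- The positions in the sequences
`(k^C_{s,1}, …, k^C_{s,μ_s})`, with `C` a conjugacy class and `μ_s` the `s`-th part of `ρ(C)`. -/
abbrev Cells (ρ : PartFun G) :=
  Σ C : ConjClasses G, Σ s : Fin (parts ρ C).length, Fin ((parts ρ C).get s)

/-- The product of the disjoint cycles `(k^C_{s,1}, …, k^C_{s,μ_s})` over all `C` and `s`, for a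
sequence `k` of pairwise distinct indices. -/
def cyclePerm (ρ : PartFun G) (k : Cells ρ ↪ Fin n) : Equiv.Perm (Fin n) :=
  Equiv.Perm.viaEmbedding
    (Equiv.sigmaCongrRight fun C => Equiv.sigmaCongrRight fun s => finRotate ((parts ρ C).get s)) k

/-- The cycle-product `g_{i_μ} ⋯ g_{i_2} g_{i_1}` of the cycle `(i_1 i_2 … i_μ)` of `k` at the
`s`-th part of `ρ(C)`. -/
def cycleProduct (ρ : PartFun G) (k : Cells ρ ↪ Fin n) (g : Fin n → G) (C : ConjClasses G)
    (s : Fin (parts ρ C).length) : G :=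
  (List.ofFn fun i : Fin ((parts ρ C).get s) => g (k ⟨C, s, i⟩)).reverse.prod

/-- The index set of the sum defining `C^ρ_{n,T}`: the sequences `k` of pairwise distinct indices
from `T` and the `g ∈ G^n` such that the cycle-product of each cycle attached to a part of `ρ(C)`
lies in `C`, and `g j = 1` for `j ∉ T`. -/
def cycleData (ρ : PartFun G) (T : Finset (Fin n)) :
    Finset ((Cells ρ ↪ Fin n) × (Fin n → G)) :=
  Finset.univ.filter fun p => (∀ c, p.1 c ∈ T) ∧
    (∀ C s, ConjClasses.mk (cycleProduct ρ p.1 p.2 C s) = C) ∧ ∀ j, j ∉ T → p.2 j = 1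

/-- The element of the wreath product given by a sequence of indices and a `g ∈ G^n`. -/
def cycleElement (ρ : PartFun G) (p : (Cells ρ ↪ Fin n) × (Fin n → G)) : GBar G n :=
  ofWreath p.2 (cyclePerm ρ p.1)

/-- The element `C^ρ_{n,T}`: the sum over all sequences, so that every element of the wreath product
occurs as often as there are sequences producing it. -/
def cycleSum (ρ : PartFun G) (T : Finset (Fin n)) : MonoidAlgebra F (GBar G n) :=
  ∑ p ∈ cycleData ρ T, MonoidAlgebra.single (cycleElement ρ p) 1

/-- The multiplicity-free version of `C^ρ_{n,T}`: the sum of the distinct elements of the wreath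
product occurring in it. -/
def reducedCycleSum (ρ : PartFun G) (T : Finset (Fin n)) : MonoidAlgebra F (GBar G n) :=
  ∑ x ∈ (cycleData ρ T).image (cycleElement ρ), MonoidAlgebra.single x 1

variable (G) in
/-- The product of the commuting idempotents `1 - ε_i`, `i ∈ T`. -/
def epsBar (T : Finset (Fin n)) : MonoidAlgebra F (GBar G n) :=
  T.noncommProd (fun i => 1 - MonoidAlgebra.single (eps i) 1) (by
    intro i _ j _ _
    have : Commute (MonoidAlgebra.single (eps i : GBar G n) (1 : F))
        (MonoidAlgebra.single (eps j : GBar G n) (1 : F)) := by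
      simp only [Commute, SemiconjBy, MonoidAlgebra.single_mul_single]
      rw [(eps_commute i j).eq]
    exact ((Commute.one_left _).sub_left ((Commute.one_right _).sub_right this)))

/-- `Δ_n^ρ`, the sum of `C^ρ_{n,T} ∏_{i ∈ T} (1 - ε_i)` over all `T` of cardinality `‖ρ‖`; it is `0`
if `‖ρ‖ > n`. -/
def Delta (n : ℕ) (ρ : PartFun G) : MonoidAlgebra F (GBar G n) :=
  ∑ T ∈ Finset.univ.powersetCard (size ρ), cycleSum F ρ T * epsBar F G T

/-- The multiplicity-free version of `Δ_n^ρ`. -/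
def reducedDelta (n : ℕ) (ρ : PartFun G) : MonoidAlgebra F (GBar G n) :=
  ∑ T ∈ Finset.univ.powersetCard (size ρ), reducedCycleSum F ρ T * epsBar F G T

end WreathLimit

end

noncomputable section

namespace WreathLimit

open scoped Classical

set_option linter.unusedSectionVars false

open GBar

/-! ### Products along the cycles of a permutation -/

section Cocycle

variable {G : Type*} [Group G] {X Y : Type*}

/-! A basis is certified by a dual family: functionals that are biorthogonal to the given vectors
and separate points (`exists_basis_of_dual`). This is carried out over an arbitrary field for the
elements `reducedDelta`; the elements `Delta` are then obtained by rescaling.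

The functionals come from one observation: right multiplication by `ε_i` replaces the `i`-th column
by zero and leaves the others alone. A functional that is a product of column weights therefore
factorises on `y ∏_{i ∈ U} (1 - ε_i)` (`typeFunctional_mul_epsBar`). For `x` in the wreath product,
trivial outside `T`, the weights are chosen so that the value is a sign when `(y, U) = (x, T)` and
zero for every other `y` with diagonal entries `1` outside `U` (`typeFunctional_orthogonal`). On
central elements the value depends only on the conjugacy class of `(x, T)`. These classes are
indexed by the `ρ` with `‖ρ‖ = |T|`: each `x` has exactly one type on `T`
(`exists_mem_typeElements`, `type_unique`), and elements of equal type are conjugate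
(`exists_conj_of_mem_typeElements`), because conjugate cycle-products along matching cycles can be
related by a gauge transformation (`exists_gauge`).

Separation (`eq_zero_of_typeFunctional_eq_zero`) is an extremal argument. In the support of a
nonzero central element take `δ` of maximal degree and, among those, of maximal rank. Commutation
with the `ε_j` forces every index of a nonzero column of `δ` to be that of a nonzero row, so filling
the zero columns with those of the identity gives an element of the wreath product, and its
functional sees only the coefficient at `δ`.

The filtered statements hold because the functional at `T` kills everything of degree less than
`|T|`. The projections send `reducedDelta` to `reducedDelta`, hence are injective on the central
elements of degree at most `k` once the target order is at least `k` (`eq_zero_of_theta_eq_zero`),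
and the limit reduces to a single level. Finally `Delta` is `reducedDelta` times the order of a
group of permutations of the cells, which divides `‖ρ‖!` (`Delta_eq`, `card_cellSymmetries_dvd`). -/

/-- The product `g (σ^m j) ⋯ g (σ j)`. -/
def orbitProduct (g : X → G) (σ : X → X) : ℕ → X → G
  | 0, _ => 1
  | m + 1, j => g (σ^[m + 1] j) * orbitProduct g σ m j

theorem orbitProduct_add (g : X → G) (σ : X → X) (m l : ℕ) (j : X) :
    orbitProduct g σ (l + m) j = orbitProduct g σ l (σ^[m] j) * orbitProduct g σ m j := by
  induction l with
  | zero => simp [orbitProduct]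
  | succ l ih =>
    rw [show l + 1 + m = (l + m) + 1 by omega, orbitProduct, orbitProduct, ih, mul_assoc,
      ← Function.iterate_add_apply, show l + m + 1 = l + 1 + m by omega]

/-- The conjugacy class of the product of `g` along the cycle of `σ` through `j`. -/
def cycleClass (g : X → G) (σ : X → X) (j : X) : ConjClasses G :=
  ConjClasses.mk (orbitProduct g σ (Function.minimalPeriod σ j) j)

/-- The hypothesis `hh` says that `h` is a gauge transformation from `g` to `g'`; along an orbit its
intermediate factors telescope. -/
theorem orbitProduct_semiconj {g : X → G} {σ : X → X} {g' : Y → G} {σ' : Y → Y} {f : X → Y}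
    {h : X → G} (hf : Function.Semiconj f σ σ')
    (hh : ∀ j, g' (f (σ j)) * h j = h (σ j) * g (σ j)) (m : ℕ) (j : X) :
    orbitProduct g' σ' m (f j) * h j = h (σ^[m] j) * orbitProduct g σ m j := by
  induction m with
  | zero => simp [orbitProduct]
  | succ m ih =>
    rw [orbitProduct, orbitProduct, mul_assoc, ih, ← hf.iterate_right (m + 1) j,
      Function.iterate_succ_apply', ← mul_assoc, hh, mul_assoc]

theorem minimalPeriod_semiconj {σ : X → X} {σ' : Y → Y} {f : X → Y} (hinj : Function.Injective f)
    (hf : Function.Semiconj f σ σ') (j : X) :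
    Function.minimalPeriod σ' (f j) = Function.minimalPeriod σ j := by
  rw [Function.minimalPeriod_eq_minimalPeriod_iff]
  intro n
  simp only [Function.IsPeriodicPt, Function.IsFixedPt]
  rw [← hf.iterate_right n j, hinj.eq_iff]

/-- Over a full period the two ends of the telescoped identity coincide, which makes it a
conjugation by `h j`. The map `f` need only be injective: it is taken to be `σ` itself, a
conjugating permutation, and the inclusion of `Fin n` in `Fin (n + 1)`. -/
theorem cycleClass_semiconj {g : X → G} {σ : X → X} {g' : Y → G} {σ' : Y → Y} {f : X → Y}
    (h : X → G) (hinj : Function.Injective f) (hf : Function.Semiconj f σ σ')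
    (hh : ∀ j, g' (f (σ j)) * h j = h (σ j) * g (σ j)) (j : X) :
    cycleClass g' σ' (f j) = cycleClass g σ j := by
  unfold cycleClass
  rw [minimalPeriod_semiconj hinj hf, ConjClasses.mk_eq_mk_iff_isConj, isConj_comm, isConj_iff]
  refine ⟨h j, ?_⟩
  have := orbitProduct_semiconj hf hh (Function.minimalPeriod σ j) j
  rw [Function.iterate_minimalPeriod] at this
  rw [← this]; group

theorem cycleClass_apply (g : X → G) (σ : Equiv.Perm X) (j : X) :
    cycleClass g σ (σ j) = cycleClass g σ j :=
  cycleClass_semiconj (fun j => g (σ j)) σ.injective (fun _ => rfl) (fun _ => rfl) j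

theorem cycleClass_iterate (g : X → G) (σ : Equiv.Perm X) (m : ℕ) (j : X) :
    cycleClass g σ (σ^[m] j) = cycleClass g σ j := by
  induction m with
  | zero => rfl
  | succ m ih => rw [Function.iterate_succ_apply', cycleClass_apply, ih]

theorem cycleClass_fixed {g : X → G} {σ : X → X} {j : X} (h : σ j = j) :
    cycleClass g σ j = ConjClasses.mk (g j) := by
  have : Function.minimalPeriod σ j = 1 := Function.minimalPeriod_eq_one_iff_isFixedPt.2 h
  simp [cycleClass, this, orbitProduct, h]

theorem mem_periodicPts_perm [Finite X] (σ : Equiv.Perm X) (j : X) :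
    j ∈ Function.periodicPts σ :=
  σ.injective.mem_periodicPts j

/-- Two functions with conjugate products along corresponding cycles differ by a gauge
transformation. -/
theorem exists_gauge [Finite X] {g g' : X → G} {σ σ' τ : Equiv.Perm X}
    (hτ : Function.Semiconj τ σ σ') (hc : ∀ j, cycleClass g' σ' (τ j) = cycleClass g σ j) :
    ∃ h : X → G, ∀ j, g' (τ (σ j)) * h j = h (σ j) * g (σ j) := by
  have hconj : ∀ j, ∃ a : G, a * orbitProduct g σ (Function.minimalPeriod σ j) j =
      orbitProduct g' σ' (Function.minimalPeriod σ j) (τ j) * a := by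
    intro j
    have := hc j
    unfold cycleClass at this
    rw [minimalPeriod_semiconj τ.injective hτ, ConjClasses.mk_eq_mk_iff_isConj, isConj_comm,
      isConj_iff] at this
    obtain ⟨a, ha⟩ := this
    exact ⟨a, by rw [← ha]; group⟩
  choose a ha using hconj
  let r : X → X := fun j => (Quotient.mk (Equiv.Perm.SameCycle.setoid σ) j).out
  have hr : ∀ j, r (σ j) = r j := by
    intro j
    have : Quotient.mk (Equiv.Perm.SameCycle.setoid σ) (σ j) =
        Quotient.mk (Equiv.Perm.SameCycle.setoid σ) j :=
      Quotient.sound (show Equiv.Perm.SameCycle σ (σ j) j from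
        Equiv.Perm.sameCycle_apply_left.2 (Equiv.Perm.SameCycle.refl _ _))
    simp only [r, this]
  have hm : ∀ j, ∃ m : ℕ, σ^[m] (r j) = j := by
    intro j
    have h1 : Equiv.Perm.SameCycle σ (r j) j :=
      Quotient.mk_out (s := Equiv.Perm.SameCycle.setoid σ) j
    obtain ⟨m, _, hm⟩ := h1.exists_pow_eq'
    exact ⟨m, by rw [Equiv.Perm.iterate_eq_pow]; exact hm⟩
  choose m hm using hm
  -- The gauge relation propagates a value along the cycle; `H x m` is what it gives `m` steps after
  -- the representative `x`, starting from `a x`.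
  let H : X → ℕ → G := fun x m =>
    orbitProduct g' σ' m (τ x) * a x * (orbitProduct g σ m x)⁻¹
  -- The choice of `a x` as a conjugating element says exactly that one full turn restores the
  -- value, so `H` depends only on the point reached.
  have hper : ∀ x, Function.Periodic (H x) (Function.minimalPeriod σ x) := by
    intro x m
    simp only [H]
    rw [orbitProduct_add, orbitProduct_add, Function.iterate_minimalPeriod,
      ← hτ.iterate_right _ x, Function.iterate_minimalPeriod, mul_assoc _ _ (a x), ← ha]
    group
  have hH : ∀ x m m', σ^[m] x = σ^[m'] x → H x m = H x m' := by
    intro x m m' h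
    rw [← (hper x).map_mod_nat m, ← (hper x).map_mod_nat m']
    congr 1
    have hp := Function.minimalPeriod_pos_of_mem_periodicPts (mem_periodicPts_perm σ x)
    refine (Function.iterate_eq_iterate_iff_of_lt_minimalPeriod (Nat.mod_lt _ hp)
      (Nat.mod_lt _ hp)).1 ?_
    rw [Function.iterate_mod_minimalPeriod_eq, Function.iterate_mod_minimalPeriod_eq, h]
  refine ⟨fun j => H (r j) (m j), fun j => ?_⟩
  have h1 : H (r (σ j)) (m (σ j)) = H (r j) (m j + 1) := by
    rw [hr]
    apply hH
    have := hm (σ j)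
    rw [hr] at this
    rw [this, Function.iterate_succ_apply', hm]
  simp only [h1]
  simp only [H, orbitProduct, Function.iterate_succ_apply', hm, ← hτ.iterate_right _ (r j), ← hτ j]
  group

end Cocycle

/-! ### The cells of a partition-valued function -/

theorem iterate_finRotate_val {μ : ℕ} (i : Fin μ) (m : ℕ) :
    ((finRotate μ)^[m] i).val = (i.val + m) % μ := by
  obtain _ | μ := μ
  · exact i.elim0
  induction m with
  | zero => simp [Nat.mod_eq_of_lt i.2]
  | succ m ih =>
    rw [Function.iterate_succ_apply', finRotate_apply, Fin.val_add, ih]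
    simp [Nat.add_mod, ← add_assoc]

theorem minimalPeriod_finRotate {μ : ℕ} (i : Fin μ) :
    Function.minimalPeriod (finRotate μ) i = μ := by
  apply Nat.dvd_antisymm
  · rw [← Function.isPeriodicPt_iff_minimalPeriod_dvd]
    apply Fin.ext
    rw [iterate_finRotate_val]
    simp [Nat.mod_eq_of_lt i.2]
  · have h := congrArg Fin.val (Function.iterate_minimalPeriod (f := finRotate μ) (x := i))
    rw [iterate_finRotate_val] at h
    have h2 : (i.val + Function.minimalPeriod (finRotate μ) i) ≡ i.val + 0 [MOD μ] := by
      rw [Nat.ModEq, h, add_zero, Nat.mod_eq_of_lt i.2]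
    exact (Nat.modEq_zero_iff_dvd).1 (Nat.ModEq.add_left_cancel' _ h2)

section Cells

variable {G : Type*} [Group G] [Fintype G] {n : ℕ}

/-- The cyclic rotation of the cells of all rows. -/
def rotCells (ρ : PartFun G) : Equiv.Perm (Cells ρ) :=
  Equiv.sigmaCongrRight fun C => Equiv.sigmaCongrRight fun s => finRotate ((parts ρ C).get s)

theorem cyclePerm_apply (ρ : PartFun G) (k : Cells ρ ↪ Fin n) (c : Cells ρ) :
    cyclePerm ρ k (k c) = k (rotCells ρ c) :=
  Equiv.Perm.viaEmbedding_apply _ _ _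

theorem cyclePerm_of_notMem (ρ : PartFun G) (k : Cells ρ ↪ Fin n) {j : Fin n}
    (h : j ∉ Set.range k) : cyclePerm ρ k j = j :=
  Equiv.Perm.viaEmbedding_apply_of_notMem _ _ _ h

theorem cyclePerm_eq {ρ : PartFun G} {k : Cells ρ ↪ Fin n} {σ : Equiv.Perm (Fin n)}
    (h : ∀ c, σ (k c) = k (rotCells ρ c)) (h' : ∀ j, j ∉ Set.range k → σ j = j) :
    cyclePerm ρ k = σ := by
  ext1 j
  by_cases hj : j ∈ Set.range k
  · obtain ⟨c, rfl⟩ := hj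
    rw [cyclePerm_apply, h]
  · rw [cyclePerm_of_notMem _ _ hj, h' j hj]

theorem iterate_rotCells (ρ : PartFun G) (C : ConjClasses G) (s : Fin (parts ρ C).length)
    (i : Fin ((parts ρ C).get s)) (m : ℕ) :
    (rotCells ρ)^[m] ⟨C, s, i⟩ = ⟨C, s, (finRotate _)^[m] i⟩ := by
  induction m with
  | zero => rfl
  | succ m ih => rw [Function.iterate_succ_apply', ih, Function.iterate_succ_apply']; rfl

theorem minimalPeriod_rotCells (ρ : PartFun G) (c : Cells ρ) :
    Function.minimalPeriod (rotCells ρ) c = (parts ρ c.1).get c.2.1 := by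
  obtain ⟨C, s, i⟩ := c
  have hinj : Function.Injective
      (fun i : Fin ((parts ρ C).get s) => (⟨C, s, i⟩ : Cells ρ)) := by
    intro i i' h
    simpa using h
  exact (minimalPeriod_semiconj hinj (fun _ => rfl) i).trans (minimalPeriod_finRotate i)

theorem minimalPeriod_cyclePerm (ρ : PartFun G) (k : Cells ρ ↪ Fin n) (c : Cells ρ) :
    Function.minimalPeriod (cyclePerm ρ k) (k c) = (parts ρ c.1).get c.2.1 := by
  rw [← minimalPeriod_rotCells]
  exact minimalPeriod_semiconj k.injective (fun c => (cyclePerm_apply ρ k c).symm) c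

theorem parts_get_pos (ρ : PartFun G) (C : ConjClasses G) (s : Fin (parts ρ C).length) :
    0 < (parts ρ C).get s :=
  (ρ C).2.parts_pos ((Multiset.mem_sort _).1 (List.get_mem (parts ρ C) s))

/-- The start is the last cell `l` of the row because `orbitProduct` begins with the factor at the
image of its starting point; the first factor met is then that of cell `0`. -/
theorem orbitProduct_cyclePerm (ρ : PartFun G) (k : Cells ρ ↪ Fin n) (g : Fin n → G)
    (C : ConjClasses G) (s : Fin (parts ρ C).length) (l : Fin ((parts ρ C).get s))
    (hl : l.val + 1 = (parts ρ C).get s) (m : ℕ) (hm : m ≤ (parts ρ C).get s) :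
    orbitProduct g (cyclePerm ρ k) m (k ⟨C, s, l⟩) =
      (List.ofFn fun i : Fin m => g (k ⟨C, s, Fin.castLE hm i⟩)).reverse.prod := by
  induction m with
  | zero => simp [orbitProduct]
  | succ m ih =>
    have hk : Function.Semiconj k (rotCells ρ) (cyclePerm ρ k) :=
      fun c => (cyclePerm_apply ρ k c).symm
    have h1 : (finRotate _)^[m + 1] l = Fin.castLE hm (Fin.last m) := by
      apply Fin.ext
      rw [iterate_finRotate_val, show l.val + (m + 1) = m + (parts ρ C).get s by omega]
      simp only [Nat.add_mod_right, Fin.val_castLE, Fin.val_last]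
      exact Nat.mod_eq_of_lt hm
    rw [orbitProduct, ih (by omega), List.ofFn_succ', List.concat_eq_append, List.reverse_append,
      List.reverse_singleton, List.singleton_append, List.prod_cons, ← hk.iterate_right,
      iterate_rotCells, h1]
    rfl

/-- The class of a cycle-product does not depend on where the cycle is entered, so the condition on
rows can be read at any cell. -/
theorem mk_cycleProduct (ρ : PartFun G) (k : Cells ρ ↪ Fin n) (g : Fin n → G) (c : Cells ρ) :
    ConjClasses.mk (cycleProduct ρ k g c.1 c.2.1) = cycleClass g (cyclePerm ρ k) (k c) := by
  obtain ⟨C, s, i⟩ := c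
  have hpos := parts_get_pos ρ C s
  let l : Fin ((parts ρ C).get s) := ⟨(parts ρ C).get s - 1, by omega⟩
  have hl : l.val + 1 = (parts ρ C).get s := by simp only [l]; omega
  have hk : Function.Semiconj k (rotCells ρ) (cyclePerm ρ k) :=
    fun c => (cyclePerm_apply ρ k c).symm
  have h1 : k ⟨C, s, i⟩ = (cyclePerm ρ k)^[i.val + 1] (k ⟨C, s, l⟩) := by
    rw [← hk.iterate_right, iterate_rotCells]
    congr 3
    apply Fin.ext
    rw [iterate_finRotate_val, show l.val + (i.val + 1) = i.val + (parts ρ C).get s by omega,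
      Nat.add_mod_right, Nat.mod_eq_of_lt i.2]
  rw [h1, cycleClass_iterate, cycleClass, minimalPeriod_cyclePerm]
  congr 1
  rw [orbitProduct_cyclePerm ρ k g C s l hl _ le_rfl]
  rfl

theorem mem_cycleData_iff {ρ : PartFun G} {T : Finset (Fin n)}
    {p : (Cells ρ ↪ Fin n) × (Fin n → G)} :
    p ∈ cycleData ρ T ↔ (∀ c, p.1 c ∈ T) ∧
      (∀ c, cycleClass p.2 (cyclePerm ρ p.1) (p.1 c) = c.1) ∧ ∀ j, j ∉ T → p.2 j = 1 := by
  simp only [cycleData, Finset.mem_filter, Finset.mem_univ, true_and]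
  refine and_congr_right fun _ => and_congr_left fun _ => ?_
  constructor
  · intro h c
    rw [← mk_cycleProduct, h]
  · intro h C s
    have := mk_cycleProduct ρ p.1 p.2 ⟨C, s, ⟨0, parts_get_pos ρ C s⟩⟩
    rw [h] at this
    exact this

theorem sum_parts (ρ : PartFun G) (C : ConjClasses G) :
    ∑ s, (parts ρ C).get s = (ρ C).1 := by
  rw [← List.sum_ofFn, List.ofFn_get, ← Multiset.sum_coe, parts, Multiset.sort_eq,
    (ρ C).2.parts_sum]

theorem card_cells (ρ : PartFun G) : Fintype.card (Cells ρ) = size ρ := by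
  simp only [Fintype.card_sigma, Fintype.card_fin, size, sum_parts]

theorem range_eq_of_card {ρ : PartFun G} {T : Finset (Fin n)} (hT : T.card = size ρ)
    {k : Cells ρ ↪ Fin n} (h : ∀ c, k c ∈ T) : Set.range k = T := by
  have : Finset.univ.map k = T := by
    apply Finset.eq_of_subset_of_card_le
    · intro j hj
      obtain ⟨c, _, rfl⟩ := Finset.mem_map.1 hj
      exact h c
    · rw [Finset.card_map, Finset.card_univ, card_cells, hT]
  rw [← this]; simp

/-- The elements of type `ρ` of the wreath product on the indices from `T`. -/
def typeElements (ρ : PartFun G) (T : Finset (Fin n)) : Finset (GBar G n) :=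
  (cycleData ρ T).image (cycleElement ρ)

theorem ofWreath_injective {g g' : Fin n → G} {σ σ' : Equiv.Perm (Fin n)}
    (h : ofWreath g σ = ofWreath g' σ') : g = g' ∧ σ = σ' := by
  have h0 : ∀ j, σ' j = σ j ∧ g (σ j) = g' (σ j) := by
    intro j
    have := congrFun (congrFun (congrArg GBar.entry h) (σ j)) j
    simp only [ofWreath, if_true] at this
    split_ifs at this with h1
    · exact ⟨h1, by exact_mod_cast this⟩
    · exact absurd this WithZero.coe_ne_zero
  refine ⟨?_, ?_⟩
  · funext i
    simpa using (h0 (σ.symm i)).2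
  · ext1 j
    exact (h0 j).1.symm

/-- Since `|T| = ‖ρ‖`, a labelling of the cells by indices from `T` exhausts `T`. Hence having type
`ρ` becomes an intrinsic condition on `(g, σ)`: trivial outside `T`, and carrying the rotation of
the cells to `σ` with the prescribed classes. -/
theorem mem_typeElements {ρ : PartFun G} {T : Finset (Fin n)} (hT : T.card = size ρ)
    {g : Fin n → G} {σ : Equiv.Perm (Fin n)} :
    ofWreath g σ ∈ typeElements ρ T ↔ (∀ j, j ∉ T → σ j = j ∧ g j = 1) ∧
      ∃ k : Cells ρ ↪ Fin n, (∀ c, k c ∈ T) ∧ (∀ c, σ (k c) = k (rotCells ρ c)) ∧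
        ∀ c, cycleClass g σ (k c) = c.1 := by
  simp only [typeElements, Finset.mem_image]
  constructor
  · rintro ⟨⟨k, g'⟩, hp, hx⟩
    obtain ⟨rfl, rfl⟩ := ofWreath_injective hx
    obtain ⟨h1, h2, h3⟩ := mem_cycleData_iff.1 hp
    refine ⟨fun j hj => ⟨cyclePerm_of_notMem _ _ ?_, h3 j hj⟩, k, h1, cyclePerm_apply ρ k, h2⟩
    rw [range_eq_of_card hT h1]
    exact hj
  · rintro ⟨h1, k, h2, h3, h4⟩
    have : cyclePerm ρ k = σ := cyclePerm_eq h3 fun j hj => (h1 j (by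
      rw [range_eq_of_card hT h2] at hj; exact hj)).1
    subst this
    exact ⟨(k, g), mem_cycleData_iff.2 ⟨h2, h4, fun j hj => (h1 j hj).2⟩, rfl⟩

theorem exists_ofWreath_of_mem {ρ : PartFun G} {T : Finset (Fin n)} {x : GBar G n}
    (h : x ∈ typeElements ρ T) : ∃ g σ, x = ofWreath g σ := by
  obtain ⟨p, _, rfl⟩ := Finset.mem_image.1 h
  exact ⟨_, _, rfl⟩

theorem typeElements_nonempty {ρ : PartFun G} {T : Finset (Fin n)} (hT : T.card = size ρ) :
    (typeElements ρ T).Nonempty := by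
  have hc : Fintype.card (Cells ρ) = Fintype.card T := by rw [card_cells, Fintype.card_coe, hT]
  let e : Cells ρ ≃ T := Fintype.equivOfCardEq hc
  let k : Cells ρ ↪ Fin n := e.toEmbedding.trans (Function.Embedding.subtype _)
  -- A representative of `C` in the first cell of each row and `1` elsewhere: the cycle-product is
  -- that representative.
  let f : Cells ρ → G := fun c => if c.2.2.val = 0 then c.1.out else 1
  let g : Fin n → G := fun j => if h : j ∈ T then f (e.symm ⟨j, h⟩) else 1
  have hg : ∀ c, g (k c) = f c := by
    intro c
    have : (k c) ∈ T := (e c).2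
    simp only [g, dif_pos this]
    congr 1
    exact e.symm_apply_apply c
  refine ⟨_, Finset.mem_image_of_mem _ (a := (k, g)) ?_⟩
  simp only [cycleData, Finset.mem_filter, Finset.mem_univ, true_and]
  refine ⟨fun c => (e c).2, fun C s => ?_, fun j hj => by simp only [g, dif_neg hj]⟩
  have hpos := parts_get_pos ρ C s
  have : cycleProduct ρ k g C s = C.out := by
    unfold cycleProduct
    simp only [hg, f]
    obtain ⟨m, hm⟩ := Nat.exists_eq_succ_of_ne_zero hpos.ne'
    generalize (parts ρ C).get s = μ at hm
    subst hm
    rw [List.ofFn_succ]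
    simp
  rw [this]
  exact Quotient.out_eq C

/-- Equal multisets of values have fibers of equal size, and bijections of the fibers glue. This
numbers the cycles in a given class by the entries of the sorted list of parts. -/
theorem exists_equiv_get_eq {β : Type*} [Fintype β] (f : β → ℕ) (l : List ℕ)
    (h : (l : Multiset ℕ) = Finset.univ.val.map f) :
    ∃ e : Fin l.length ≃ β, ∀ s, f (e s) = l.get s := by
  have h' : (Finset.univ.val.map l.get : Multiset ℕ) = Finset.univ.val.map f := by
    rw [Fin.univ_val_map, List.ofFn_get, h]
  have hc : ∀ m, Nonempty ({s // l.get s = m} ≃ {b // f b = m}) := by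
    intro m
    apply Fintype.card_eq.1
    rw [Fintype.card_subtype, Fintype.card_subtype]
    have := congrArg (Multiset.count m) h'
    rw [Multiset.count_map, Multiset.count_map] at this
    simpa only [Finset.card_def, Finset.filter_val, eq_comm] using this
  exact ⟨Equiv.ofFiberEquiv fun m => (hc m).some, fun s => Equiv.ofFiberEquiv_map _ s⟩

/-- The type is read off the cycles of `σ` inside `T`, fixed points included: their lengths, sorted
by the class of the cycle-product. -/
theorem exists_mem_typeElements {T : Finset (Fin n)} {g : Fin n → G} {σ : Equiv.Perm (Fin n)}
    (hx : ∀ j, j ∉ T → σ j = j ∧ g j = 1) :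
    ∃ ρ : PartFun G, T.card = size ρ ∧ ofWreath g σ ∈ typeElements ρ T := by
  have hσT : ∀ j ∈ T, σ j ∈ T := by
    intro j hj
    by_contra hc
    have := σ.injective (hx _ hc).1
    rw [this] at hc
    exact hc hj
  have hσT' : ∀ (m : ℕ), ∀ j ∈ T, σ^[m] j ∈ T := by
    intro m j hj
    induction m with
    | zero => exact hj
    | succ m ih => rw [Function.iterate_succ_apply']; exact hσT _ ih
  let Q := Quotient (Equiv.Perm.SameCycle.setoid σ)
  let Ω := {ω : Q // ω.out ∈ T}
  let r : Ω → Fin n := fun ω => ω.1.out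
  let ℓ : Ω → ℕ := fun ω => Function.minimalPeriod σ (r ω)
  let cls : Ω → ConjClasses G := fun ω => cycleClass g σ (r ω)
  let ms : ConjClasses G → Multiset ℕ := fun C =>
    (Finset.univ : Finset {ω // cls ω = C}).val.map fun ω => ℓ ω.1
  let ρ : PartFun G := fun C => ⟨(ms C).sum, ⟨ms C, by
    intro i hi
    obtain ⟨ω, _, rfl⟩ := Multiset.mem_map.1 hi
    exact Function.minimalPeriod_pos_of_mem_periodicPts (mem_periodicPts_perm σ _), rfl⟩⟩
  have he : ∀ C, ∃ e : Fin (parts ρ C).length ≃ {ω // cls ω = C},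
      ∀ s, ℓ (e s).1 = (parts ρ C).get s := by
    intro C
    exact exists_equiv_get_eq (fun ω : {ω // cls ω = C} => ℓ ω.1) _ (Multiset.sort_eq _ _)
  choose e he using he
  -- Cell number `i` of a row receives the point `i` steps after the chosen representative of the
  -- cycle matched with that row.
  let k0 : Cells ρ → Fin n := fun c => σ^[c.2.2.val] (r (e c.1 c.2.1).1)
  have hr : ∀ ω ω' : Ω, Equiv.Perm.SameCycle σ (r ω) (r ω') → ω = ω' := by
    intro ω ω' h
    apply Subtype.ext
    rw [← Quotient.out_eq ω.1, ← Quotient.out_eq ω'.1]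
    exact Quotient.sound h
  have hinj : Function.Injective k0 := by
    rintro ⟨C, s, i⟩ ⟨C', s', i'⟩ h
    simp only [k0] at h
    have hω : (e C s).1 = (e C' s').1 := by
      apply hr
      have h1 : ∀ (m : ℕ) x, Equiv.Perm.SameCycle σ x (σ^[m] x) := by
        intro m x
        rw [Equiv.Perm.iterate_eq_pow]
        exact ⟨m, by simp⟩
      exact (h1 i.val _).trans (h ▸ (h1 i'.val _).symm)
    obtain rfl : C = C' := by rw [← (e C s).2, hω, (e C' s').2]
    obtain rfl : s = s' := (e C).injective (Subtype.ext hω)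
    congr 2
    apply Fin.ext
    refine (Function.iterate_eq_iterate_iff_of_lt_minimalPeriod ?_ ?_).1 h
    · exact i.2.trans_eq (he C s).symm
    · exact i'.2.trans_eq (he C s).symm
  have hmem : ∀ c, k0 c ∈ T := fun c => hσT' _ _ (e c.1 c.2.1).1.2
  have hsurj : ∀ j ∈ T, ∃ c, k0 c = j := by
    intro j hj
    have h1 : Equiv.Perm.SameCycle σ (Quotient.mk (Equiv.Perm.SameCycle.setoid σ) j).out j :=
      Quotient.mk_out (s := Equiv.Perm.SameCycle.setoid σ) j
    have h2 : (Quotient.mk (Equiv.Perm.SameCycle.setoid σ) j).out ∈ T := by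
      obtain ⟨m, _, hm⟩ := h1.symm.exists_pow_eq'
      rw [← hm, ← Equiv.Perm.iterate_eq_pow]
      exact hσT' _ _ hj
    let ω : Ω := ⟨Quotient.mk (Equiv.Perm.SameCycle.setoid σ) j, h2⟩
    obtain ⟨m, _, hm⟩ := h1.exists_pow_eq'
    obtain ⟨s, hs⟩ := (e (cls ω)).surjective ⟨ω, rfl⟩
    have hs' : (parts ρ (cls ω)).get s = ℓ ω := by rw [← he, hs]
    have hpos : 0 < ℓ ω :=
      Function.minimalPeriod_pos_of_mem_periodicPts (mem_periodicPts_perm σ _)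
    refine ⟨⟨cls ω, s, ⟨m % ℓ ω, by rw [hs']; exact Nat.mod_lt _ hpos⟩⟩, ?_⟩
    simp only [k0, hs]
    rw [Function.iterate_mod_minimalPeriod_eq, Equiv.Perm.iterate_eq_pow]
    exact hm
  have hcard : T.card = size ρ := by
    rw [← card_cells, ← Finset.card_univ, ← Finset.card_image_of_injective _ hinj]
    congr 1
    ext j
    simp only [Finset.mem_image, Finset.mem_univ, true_and]
    exact ⟨hsurj j, fun ⟨c, hc⟩ => hc ▸ hmem c⟩
  refine ⟨ρ, hcard, (mem_typeElements hcard).2 ⟨hx, ⟨k0, hinj⟩, hmem, ?_, ?_⟩⟩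
  · rintro ⟨C, s, i⟩
    have h1 : (finRotate _ i).val = (i.val + 1) % ((parts ρ C).get s) :=
      iterate_finRotate_val i 1
    change σ (σ^[i.val] (r (e C s).1)) = σ^[(finRotate _ i).val] (r (e C s).1)
    have h2 : ∀ m, σ^[(m + 1) % (parts ρ C).get s] (r (e C s).1) = σ (σ^[m] (r (e C s).1)) := by
      intro m
      rw [← he, Function.iterate_mod_minimalPeriod_eq, Function.iterate_succ_apply']
    rw [h1, h2]
  · rintro ⟨C, s, i⟩
    change cycleClass g σ (σ^[i.val] (r (e C s).1)) = C
    rw [cycleClass_iterate]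
    exact (e C s).2

theorem card_cells_filter (ρ : PartFun G) (C : ConjClasses G) (m : ℕ) :
    (Finset.univ.filter fun c : Cells ρ => c.1 = C ∧ (parts ρ c.1).get c.2.1 = m).card =
      m * (ρ C).2.parts.count m := by
  have h1 : (ρ C).2.parts.count m =
      (Finset.univ.filter fun s : Fin (parts ρ C).length => (parts ρ C).get s = m).card := by
    have : (ρ C).2.parts = Finset.univ.val.map (parts ρ C).get := by
      rw [Fin.univ_val_map, List.ofFn_get, parts, Multiset.sort_eq]
    rw [this, Multiset.count_map]
    simp only [Finset.card_def, Finset.filter_val, eq_comm]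
  rw [Finset.card_filter, Fintype.sum_sigma, Finset.sum_eq_single C]
  · rw [Fintype.sum_sigma, h1, Finset.card_filter, Finset.mul_sum]
    refine Finset.sum_congr rfl fun s _ => ?_
    by_cases h : (parts ρ C).get s = m
    · simp only [h, and_self, if_true]
      simp only [Finset.sum_const, Finset.card_univ, Fintype.card_fin, h, smul_eq_mul]
    · simp only [h, and_false, if_false, Finset.sum_const_zero, mul_zero]
  · intro C' _ h
    exact Finset.sum_eq_zero fun _ _ => if_neg fun h' => h h'.1
  · simp

/-- The multiplicity of the part `m` in `ρ(C)` is recovered by counting the indices of `T` on cycles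
of length `m` and class `C`: each such part contributes `m` of them. -/
theorem type_unique {ρ ρ' : PartFun G} {T : Finset (Fin n)} (hT : T.card = size ρ)
    (hT' : T.card = size ρ') {x : GBar G n} (hx : x ∈ typeElements ρ T)
    (hx' : x ∈ typeElements ρ' T) : ρ = ρ' := by
  obtain ⟨g, σ, rfl⟩ := exists_ofWreath_of_mem hx
  have key : ∀ ρ : PartFun G, T.card = size ρ → ofWreath g σ ∈ typeElements ρ T →
      ∀ C m, m * (ρ C).2.parts.count m =
      (T.filter fun j => cycleClass g σ j = C ∧ Function.minimalPeriod σ j = m).card := by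
    intro ρ hT hx C m
    obtain ⟨h1, k, h2, h3, h4⟩ := (mem_typeElements hT).1 hx
    have hper : ∀ c, Function.minimalPeriod σ (k c) = (parts ρ c.1).get c.2.1 := fun c => by
      rw [← minimalPeriod_rotCells]
      exact minimalPeriod_semiconj k.injective (fun c => (h3 c).symm) c
    rw [← card_cells_filter, ← Finset.card_map k]
    congr 1
    ext j
    simp only [Finset.mem_map, Finset.mem_filter, Finset.mem_univ, true_and]
    constructor
    · rintro ⟨c, ⟨h5, h6⟩, rfl⟩
      exact ⟨h2 c, by rw [h4, h5], by rw [hper, h6]⟩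
    · rintro ⟨hj, h5, h6⟩
      have : j ∈ Set.range k := by rw [range_eq_of_card hT h2]; exact hj
      obtain ⟨c, rfl⟩ := this
      exact ⟨c, ⟨by rw [← h5, h4], by rw [← h6, hper]⟩, rfl⟩
  funext C
  have hparts : (ρ C).2.parts = (ρ' C).2.parts := by
    ext m
    -- The count says nothing for `m = 0`, but partitions have no zero parts.
    rcases Nat.eq_zero_or_pos m with rfl | hm
    · rw [Multiset.count_eq_zero_of_notMem, Multiset.count_eq_zero_of_notMem]
      · exact fun h => absurd ((ρ' C).2.parts_pos h) (lt_irrefl 0)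
      · exact fun h => absurd ((ρ C).2.parts_pos h) (lt_irrefl 0)
    · exact Nat.eq_of_mul_eq_mul_left hm ((key ρ hT hx C m).trans (key ρ' hT' hx' C m).symm)
  generalize ρ C = a at hparts
  generalize ρ' C = b at hparts
  obtain ⟨m, a, h1, h2⟩ := a
  obtain ⟨m', b, h1', h2'⟩ := b
  simp only at hparts
  subst hparts
  subst h2
  subst h2'
  rfl

end Cells

/-! ### Conjugation by elements of the wreath product -/

section Conj

variable {G : Type*} [Group G] {n : ℕ}

theorem ofWreath_entry (g : Fin n → G) (σ : Equiv.Perm (Fin n)) (i j : Fin n) :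
    (ofWreath g σ).entry i j = if σ j = i then (g i : WithZero G) else 0 := rfl

theorem ofWreath_mul_entry (h : Fin n → G) (τ : Equiv.Perm (Fin n)) (A : GBar G n) (i j : Fin n) :
    (ofWreath h τ * A).entry (τ i) j = h (τ i) * A.entry i j := by
  apply eq_of_coe_iff
  intro a
  rw [mul_entry_eq_coe]
  constructor
  · rintro ⟨l, hl⟩
    rw [ofWreath_entry] at hl
    split_ifs at hl with h1
    · obtain rfl := τ.injective h1
      exact hl
    · simp at hl
  · intro ha
    exact ⟨i, by rw [ofWreath_entry, if_pos rfl, ha]⟩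

theorem mul_ofWreath_entry (h : Fin n → G) (τ : Equiv.Perm (Fin n)) (A : GBar G n) (i j : Fin n) :
    (A * ofWreath h τ).entry i j = A.entry i (τ j) * h (τ j) := by
  apply eq_of_coe_iff
  intro a
  rw [mul_entry_eq_coe]
  constructor
  · rintro ⟨l, hl⟩
    rw [ofWreath_entry] at hl
    split_ifs at hl with h1
    · rwa [h1]
    · simp at hl
  · intro ha
    exact ⟨τ j, by rw [ofWreath_entry, if_pos rfl, ha]⟩

/-- The elements of the wreath product as units. -/
def wreathUnit (h : Fin n → G) (τ : Equiv.Perm (Fin n)) : (GBar G n)ˣ where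
  val := ofWreath h τ
  inv := ofWreath (fun i => (h (τ i))⁻¹) τ⁻¹
  val_inv := by
    apply GBar.ext
    funext i j
    obtain ⟨i, rfl⟩ := τ.surjective i
    rw [ofWreath_mul_entry, ofWreath_entry, one_entry]
    by_cases hij : j = τ i
    · subst hij; simp
    · rw [if_neg (fun h => hij (by rw [← h]; simp)), if_neg (Ne.symm hij), mul_zero]
  inv_val := by
    apply GBar.ext
    funext i j
    rw [mul_ofWreath_entry, ofWreath_entry, one_entry]
    by_cases hij : i = j
    · subst hij; simp
    · rw [if_neg (fun h => hij (by rw [← h]; simp)), if_neg hij, zero_mul]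

theorem wreathUnit_val (h : Fin n → G) (τ : Equiv.Perm (Fin n)) :
    (wreathUnit h τ : GBar G n) = ofWreath h τ := rfl

/-- Conjugation by an element of the wreath product. -/
def wreathConj (h : Fin n → G) (τ : Equiv.Perm (Fin n)) (A : GBar G n) : GBar G n :=
  wreathUnit h τ * A * ↑(wreathUnit h τ)⁻¹

theorem conj_entry (h : Fin n → G) (τ : Equiv.Perm (Fin n)) (A : GBar G n) (i j : Fin n) :
    (wreathConj h τ A).entry (τ i) (τ j) =
      h (τ i) * A.entry i j * (h (τ j) : WithZero G)⁻¹ := by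
  change (ofWreath h τ * A * ofWreath (fun i => (h (τ i))⁻¹) τ⁻¹).entry (τ i) (τ j) = _
  rw [mul_ofWreath_entry, ofWreath_mul_entry]
  simp

theorem conj_ofWreath (h g : Fin n → G) (τ σ : Equiv.Perm (Fin n)) :
    wreathConj h τ (ofWreath g σ) =
      ofWreath (fun i => h i * g (τ⁻¹ i) * (h (τ (σ⁻¹ (τ⁻¹ i))))⁻¹) (τ * σ * τ⁻¹) := by
  apply GBar.ext
  funext i j
  obtain ⟨i, rfl⟩ := τ.surjective i
  obtain ⟨j, rfl⟩ := τ.surjective j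
  rw [conj_entry, ofWreath_entry, ofWreath_entry]
  by_cases hij : σ j = i
  · subst hij; simp
  · rw [if_neg hij, if_neg (by simpa using hij)]; simp

theorem conj_inv (h : Fin n → G) (τ : Equiv.Perm (Fin n)) :
    (wreathUnit h τ)⁻¹ = wreathUnit (fun i => (h (τ i))⁻¹) τ⁻¹ := Units.ext rfl

theorem wreathUnit_mul_eps (h : Fin n → G) (τ : Equiv.Perm (Fin n)) (i : Fin n) :
    (wreathUnit h τ : GBar G n) * eps i = eps (τ i) * (wreathUnit h τ : GBar G n) := by
  apply GBar.ext
  funext a b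
  rw [mul_eps_entry, eps_mul_entry, wreathUnit_val, ofWreath_entry]
  by_cases hb : b = i
  · subst hb
    by_cases ha : a = τ b
    · simp [ha]
    · simp [ha, Ne.symm ha]
  · by_cases ha : a = τ i
    · subst ha; simp [hb]
    · simp [ha, hb]

variable [Fintype G]

theorem conj_mem_typeElements {ρ : PartFun G} {T : Finset (Fin n)} (hT : T.card = size ρ)
    {x : GBar G n} (hx : x ∈ typeElements ρ T) (h : Fin n → G) (τ : Equiv.Perm (Fin n)) :
    wreathConj h τ x ∈ typeElements ρ (T.map τ.toEmbedding) := by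
  obtain ⟨g, σ, rfl⟩ := exists_ofWreath_of_mem hx
  obtain ⟨h1, k, h2, h3, h4⟩ := (mem_typeElements hT).1 hx
  rw [conj_ofWreath, mem_typeElements (by rwa [Finset.card_map])]
  refine ⟨fun j hj => ?_, k.trans τ.toEmbedding, fun c => ?_, fun c => ?_, fun c => ?_⟩
  · obtain ⟨j, rfl⟩ := τ.surjective j
    have hj' : j ∉ T := fun h => hj (Finset.mem_map_of_mem τ.toEmbedding h)
    have h5 : σ⁻¹ j = j := by rw [Equiv.Perm.inv_eq_iff_eq]; exact (h1 j hj').1.symm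
    have h6 : τ⁻¹ (τ j) = j := Equiv.symm_apply_apply τ j
    simp only [Equiv.Perm.mul_apply, h6, h5, (h1 j hj').1, (h1 j hj').2, mul_one, mul_inv_cancel,
      and_self]
  · exact Finset.mem_map_of_mem _ (h2 c)
  · simp [h3]
  · rw [← h4 c]
    exact cycleClass_semiconj (fun j => h (τ j)) τ.injective (fun j => by simp)
      (fun j => by simp) (k c)

/-- Matching two labellings cell by cell, with any extension outside `T`, gives a `τ` that carries
`σ` to `σ'`. Corresponding cycles then have conjugate products, and `exists_gauge` supplies the
`G^n`-part of the conjugating element. -/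
theorem exists_conj_of_mem_typeElements {ρ : PartFun G} {T T' : Finset (Fin n)}
    (hT : T.card = size ρ) (hT' : T'.card = size ρ) {x x' : GBar G n} (hx : x ∈ typeElements ρ T)
    (hx' : x' ∈ typeElements ρ T') : ∃ (h : Fin n → G) (τ : Equiv.Perm (Fin n)), T' = T.map τ.toEmbedding ∧
      wreathConj h τ x = x' := by
  obtain ⟨g, σ, rfl⟩ := exists_ofWreath_of_mem hx
  obtain ⟨g', σ', rfl⟩ := exists_ofWreath_of_mem hx'
  obtain ⟨h1, k, h2, h3, h4⟩ := (mem_typeElements hT).1 hx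
  obtain ⟨h1', k', h2', h3', h4'⟩ := (mem_typeElements hT').1 hx'
  have hr := range_eq_of_card hT h2
  have hr' := range_eq_of_card hT' h2'
  obtain ⟨τ, hτ⟩ : ∃ τ : Equiv.Perm (Fin n), ∀ c, τ (k c) = k' c := by
    let e : {j // j ∈ Set.range k} ≃ {j // j ∈ Set.range k'} :=
      (Equiv.ofInjective k k.injective).symm.trans (Equiv.ofInjective k' k'.injective)
    refine ⟨e.extendSubtype, fun c => ?_⟩
    rw [Equiv.extendSubtype_apply_of_mem e _ ⟨c, rfl⟩]
    have : e ⟨k c, ⟨c, rfl⟩⟩ = Equiv.ofInjective k' k'.injective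
        ((Equiv.ofInjective k k.injective).symm (Equiv.ofInjective k k.injective c)) := rfl
    rw [this, Equiv.symm_apply_apply, Equiv.ofInjective_apply]
  have hTT : T' = T.map τ.toEmbedding := by
    ext j
    rw [← Finset.mem_coe, ← hr', Finset.mem_map]
    constructor
    · rintro ⟨c, rfl⟩
      exact ⟨k c, h2 c, hτ c⟩
    · rintro ⟨i, hi, rfl⟩
      rw [← Finset.mem_coe, ← hr] at hi
      obtain ⟨c, rfl⟩ := hi
      exact ⟨c, (hτ c).symm⟩
  have hnot : ∀ j, j ∉ Set.range k → j ∉ T ∧ τ j ∉ T' := by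
    intro j hj
    rw [hr, Finset.mem_coe] at hj
    exact ⟨hj, fun h => hj (by rw [hTT] at h; simpa using h)⟩
  have hsemi : Function.Semiconj τ σ σ' := by
    intro j
    by_cases hj : j ∈ Set.range k
    · obtain ⟨c, rfl⟩ := hj
      rw [h3, hτ, hτ, h3']
    · rw [(h1 j (hnot j hj).1).1, (h1' _ (hnot j hj).2).1]
  have hcls : ∀ j, cycleClass g' σ' (τ j) = cycleClass g σ j := by
    intro j
    by_cases hj : j ∈ Set.range k
    · obtain ⟨c, rfl⟩ := hj
      rw [hτ, h4, h4']
    · rw [cycleClass_fixed (h1 j (hnot j hj).1).1, cycleClass_fixed (h1' _ (hnot j hj).2).1,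
        (h1 j (hnot j hj).1).2, (h1' _ (hnot j hj).2).2]
  obtain ⟨H, hH⟩ := exists_gauge hsemi hcls
  refine ⟨fun i => H (τ⁻¹ i), τ, hTT, ?_⟩
  rw [conj_ofWreath]
  have hσ : σ' = τ * σ * τ⁻¹ := by
    ext1 j
    have := hsemi (τ⁻¹ j)
    simpa using this.symm
  rw [← hσ]
  congr 1
  funext i
  obtain ⟨j, rfl⟩ := (σ.trans τ).surjective i
  have := hH j
  have h6 : ∀ i, τ⁻¹ (τ i) = i := Equiv.symm_apply_apply τ
  have h7 : σ⁻¹ (σ j) = j := Equiv.symm_apply_apply σ j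
  simp only [Equiv.trans_apply, h6, h7]
  rw [← this]; group

end Conj

/-! ### Restriction to the upper left corner -/

section Corner

variable {G : Type*} [Group G] [Fintype G] {n : ℕ}

theorem castSucc_mem_typeElements_iff {ρ : PartFun G} {T : Finset (Fin n)} (hT : T.card = size ρ)
    {g : Fin n → G} {σ : Equiv.Perm (Fin n)} {g' : Fin (n + 1) → G}
    {σ' : Equiv.Perm (Fin (n + 1))} (hσ : ∀ j, σ' (Fin.castSucc j) = Fin.castSucc (σ j))
    (hg : ∀ j, g' (Fin.castSucc j) = g j) (hσl : σ' (Fin.last n) = Fin.last n)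
    (hgl : g' (Fin.last n) = 1) :
    ofWreath g' σ' ∈ typeElements ρ (T.map Fin.castSuccEmb) ↔ ofWreath g σ ∈ typeElements ρ T := by
  have hcls : ∀ j, cycleClass g' σ' (Fin.castSucc j) = cycleClass g σ j := fun j =>
    cycleClass_semiconj (fun _ => 1) (Fin.castSucc_injective n) (fun j => (hσ j).symm)
      (fun j => by simp [hg]) j
  rw [mem_typeElements (by rwa [Finset.card_map]), mem_typeElements hT]
  have hmem : ∀ j : Fin n, Fin.castSucc j ∈ T.map Fin.castSuccEmb ↔ j ∈ T := fun j => by simp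
  constructor
  · rintro ⟨h1, k, h2, h3, h4⟩
    refine ⟨fun j hj => ?_, ?_⟩
    · have := h1 _ ((hmem j).not.2 hj)
      rw [hσ, hg] at this
      exact ⟨Fin.castSucc_injective _ this.1, this.2⟩
    · have : ∀ c, ∃ j ∈ T, Fin.castSucc j = k c := fun c => by
        simpa using h2 c
      choose k0 hk0 hk using this
      refine ⟨⟨k0, fun c c' h => k.injective (by rw [← hk, ← hk, h])⟩, hk0, fun c => ?_,
        fun c => ?_⟩
      · apply Fin.castSucc_injective
        change Fin.castSucc (σ (k0 c)) = Fin.castSucc (k0 (rotCells ρ c))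
        rw [← hσ, hk, hk, h3]
      · change cycleClass g σ (k0 c) = c.1
        rw [← hcls, hk, h4]
  · rintro ⟨h1, k, h2, h3, h4⟩
    refine ⟨fun j hj => ?_, k.trans Fin.castSuccEmb, fun c => (hmem _).2 (h2 c), fun c => ?_,
      fun c => ?_⟩
    · cases j using Fin.lastCases with
      | last => exact ⟨hσl, hgl⟩
      | cast j =>
        have := h1 _ ((hmem j).not.1 hj)
        rw [hσ, hg, this.1, this.2]
        exact ⟨rfl, rfl⟩
    · simp [hσ, h3]
    · simp [hcls, h4]

theorem corner_ofWreath {g : Fin n → G} {σ : Equiv.Perm (Fin n)} {g' : Fin (n + 1) → G}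
    {σ' : Equiv.Perm (Fin (n + 1))} (hσ : ∀ j, σ' (Fin.castSucc j) = Fin.castSucc (σ j))
    (hg : ∀ j, g' (Fin.castSucc j) = g j) : corner (ofWreath g' σ') = ofWreath g σ := by
  apply GBar.ext
  funext i j
  simp [corner, ofWreath_entry, hσ, hg]

theorem last_notMem_map_castSucc (T : Finset (Fin n)) : Fin.last n ∉ T.map Fin.castSuccEmb := by
  simp

theorem corner_mem_typeElements {ρ : PartFun G} {T : Finset (Fin n)} (hT : T.card = size ρ)
    {x : GBar G (n + 1)} (hx : x ∈ typeElements ρ (T.map Fin.castSuccEmb)) :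
    corner x ∈ typeElements ρ T := by
  obtain ⟨g', σ', rfl⟩ := exists_ofWreath_of_mem hx
  obtain ⟨hσl, hgl⟩ := ((mem_typeElements (by rwa [Finset.card_map])).1 hx).1 _
    (last_notMem_map_castSucc T)
  have h : ∀ j : Fin n, ∃ i : Fin n, Fin.castSucc i = σ' (Fin.castSucc j) := by
    intro j
    apply Fin.exists_castSucc_eq.2
    intro h
    exact Fin.castSucc_ne_last j (σ'.injective (h.trans hσl.symm))
  choose f hf using h
  have hinj : Function.Injective f := fun i j h =>
    Fin.castSucc_injective _ (σ'.injective (by rw [← hf, ← hf, h]))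
  let σ : Equiv.Perm (Fin n) := Equiv.ofBijective f (Finite.injective_iff_bijective.1 hinj)
  have hσ : ∀ j, σ' (Fin.castSucc j) = Fin.castSucc (σ j) := fun j => (hf j).symm
  rw [corner_ofWreath hσ fun j => rfl]
  exact (castSucc_mem_typeElements_iff hT hσ (fun j => rfl) hσl hgl).1 hx

theorem exists_corner_eq {ρ : PartFun G} {T : Finset (Fin n)} (hT : T.card = size ρ)
    {y : GBar G n} (hy : y ∈ typeElements ρ T) :
    ∃ x ∈ typeElements ρ (T.map Fin.castSuccEmb), corner x = y := by
  obtain ⟨g, σ, rfl⟩ := exists_ofWreath_of_mem hy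
  let σ' : Equiv.Perm (Fin (n + 1)) := σ.viaEmbedding Fin.castSuccEmb
  have hσ : ∀ j, σ' (Fin.castSucc j) = Fin.castSucc (σ j) := fun j =>
    Equiv.Perm.viaEmbedding_apply σ Fin.castSuccEmb j
  have hσl : σ' (Fin.last n) = Fin.last n :=
    Equiv.Perm.viaEmbedding_apply_of_notMem σ Fin.castSuccEmb _ (by simp)
  let g' : Fin (n + 1) → G := Fin.snoc g 1
  have hg : ∀ j, g' (Fin.castSucc j) = g j := fun j => Fin.snoc_castSucc (α := fun _ => G) 1 g j
  have hgl : g' (Fin.last n) = 1 := Fin.snoc_last (α := fun _ => G) 1 g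
  exact ⟨ofWreath g' σ', (castSucc_mem_typeElements_iff hT hσ hg hσl hgl).2 hy,
    corner_ofWreath hσ hg⟩

/-- A nonzero entry in the last diagonal position leaves no room for others in the last row and
column. -/
theorem eq_of_corner_eq {x y : GBar G (n + 1)} (hx : x.entry (Fin.last n) (Fin.last n) ≠ 0)
    (hxy : x.entry (Fin.last n) (Fin.last n) = y.entry (Fin.last n) (Fin.last n))
    (h : corner x = corner y) : x = y := by
  have key : ∀ z : GBar G (n + 1), z.entry (Fin.last n) (Fin.last n) ≠ 0 → ∀ j : Fin n,
      z.entry (Fin.last n) j.castSucc = 0 ∧ z.entry j.castSucc (Fin.last n) = 0 := by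
    intro z hz j
    constructor
    · by_contra hc
      exact Fin.castSucc_ne_last j (z.row_unique _ _ _ hc hz)
    · by_contra hc
      exact Fin.castSucc_ne_last j (z.col_unique _ _ _ hc hz)
  have hy := hx
  rw [hxy] at hy
  apply GBar.ext
  funext i j
  cases i using Fin.lastCases with
  | last =>
    cases j using Fin.lastCases with
    | last => exact hxy
    | cast j => rw [(key x hx j).1, (key y hy j).1]
  | cast i =>
    cases j using Fin.lastCases with
    | last => rw [(key x hx i).2, (key y hy i).2]
    | cast j => exact congrFun (congrFun (congrArg GBar.entry h) i) j

theorem entry_of_notMem {ρ : PartFun G} {T : Finset (Fin n)} (hT : T.card = size ρ)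
    {x : GBar G n} (hx : x ∈ typeElements ρ T) {i : Fin n} (hi : i ∉ T) : x.entry i i = 1 := by
  obtain ⟨g, σ, rfl⟩ := exists_ofWreath_of_mem hx
  obtain ⟨h1, h2⟩ := ((mem_typeElements hT).1 hx).1 i hi
  simp [ofWreath_entry, h1, h2]

theorem corner_injOn {ρ : PartFun G} {T : Finset (Fin n)} (hT : T.card = size ρ)
    {x y : GBar G (n + 1)} (hx : x ∈ typeElements ρ (T.map Fin.castSuccEmb))
    (hy : y ∈ typeElements ρ (T.map Fin.castSuccEmb)) (h : corner x = corner y) : x = y := by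
  have hT' : (T.map Fin.castSuccEmb).card = size ρ := by rwa [Finset.card_map]
  have h1 := entry_of_notMem hT' hx (last_notMem_map_castSucc T)
  have h2 := entry_of_notMem hT' hy (last_notMem_map_castSucc T)
  exact eq_of_corner_eq (by rw [h1]; exact one_ne_zero) (by rw [h1, h2]) h

end Corner

/-! ### Multiplicities -/

section Multiplicity

variable {G : Type*} [Group G] [Fintype G] {n : ℕ}

/-- The permutations of the cells which commute with the rotation and respect the classes. -/
def cellSymmetries (ρ : PartFun G) : Subgroup (Equiv.Perm (Cells ρ)) where
  carrier := {π | (∀ c, π (rotCells ρ c) = rotCells ρ (π c)) ∧ ∀ c, (π c).1 = c.1}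
  mul_mem' := by
    rintro π π' ⟨h1, h2⟩ ⟨h1', h2'⟩
    exact ⟨fun c => by simp [h1, h1'], fun c => by simp [h2, h2']⟩
  one_mem' := ⟨fun _ => rfl, fun _ => rfl⟩
  inv_mem' := by
    rintro π ⟨h1, h2⟩
    refine ⟨fun c => ?_, fun c => ?_⟩
    · rw [Equiv.Perm.inv_eq_iff_eq, h1]
      simp
    · rw [← h2]
      simp

theorem card_cellSymmetries_dvd (ρ : PartFun G) :
    Nat.card (cellSymmetries ρ) ∣ (size ρ).factorial := by
  have := Subgroup.card_subgroup_dvd_card (cellSymmetries ρ)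
  rwa [Nat.card_perm, Nat.card_eq_fintype_card (α := Cells ρ), card_cells] at this

theorem comp_cellSymmetry_mem {ρ : PartFun G} {T : Finset (Fin n)} {k : Cells ρ ↪ Fin n}
    {g : Fin n → G} (hp : (k, g) ∈ cycleData ρ T) {π : Equiv.Perm (Cells ρ)}
    (hπ : π ∈ cellSymmetries ρ) :
    cyclePerm ρ (π.toEmbedding.trans k) = cyclePerm ρ k ∧
      (π.toEmbedding.trans k, g) ∈ cycleData ρ T := by
  obtain ⟨h1, h2, h3⟩ := mem_cycleData_iff.1 hp
  obtain ⟨hπ1, hπ2⟩ := hπ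
  have hperm : cyclePerm ρ (π.toEmbedding.trans k) = cyclePerm ρ k := by
    apply cyclePerm_eq
    · intro c
      change cyclePerm ρ k (k (π c)) = k (π (rotCells ρ c))
      rw [cyclePerm_apply, hπ1]
    · intro j hj
      refine cyclePerm_of_notMem _ _ fun ⟨c, hc⟩ => hj ⟨π.symm c, ?_⟩
      change k (π (π.symm c)) = j
      rw [Equiv.apply_symm_apply, hc]
  refine ⟨hperm, mem_cycleData_iff.2 ⟨fun c => h1 _, fun c => ?_, h3⟩⟩
  change cycleClass g (cyclePerm ρ (π.toEmbedding.trans k)) (k (π c)) = c.1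
  rw [hperm]
  exact (h2 (π c)).trans (hπ2 c)

theorem exists_cellSymmetry {ρ : PartFun G} {T : Finset (Fin n)} (hT : T.card = size ρ)
    {k k' : Cells ρ ↪ Fin n} {g : Fin n → G} (hp : (k, g) ∈ cycleData ρ T)
    (hp' : (k', g) ∈ cycleData ρ T) (hσ : cyclePerm ρ k' = cyclePerm ρ k) :
    ∃ π ∈ cellSymmetries ρ, π.toEmbedding.trans k = k' := by
  obtain ⟨h1, h2, _⟩ := mem_cycleData_iff.1 hp
  obtain ⟨h1', h2', _⟩ := mem_cycleData_iff.1 hp'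
  have hr : Set.range k' = Set.range k :=
    (range_eq_of_card hT h1').trans (range_eq_of_card hT h1).symm
  obtain ⟨π, hπ⟩ : ∃ π : Equiv.Perm (Cells ρ), ∀ c, k (π c) = k' c := by
    refine ⟨(Equiv.ofInjective k' k'.injective).trans
      ((Equiv.setCongr hr).trans (Equiv.ofInjective k k.injective).symm), fun c => ?_⟩
    simp only [Equiv.trans_apply]
    rw [Equiv.apply_ofInjective_symm k.injective]
    rfl
  refine ⟨π, ⟨fun c => ?_, fun c => ?_⟩, DFunLike.ext _ _ hπ⟩
  · apply k.injective
    rw [hπ, ← cyclePerm_apply, hσ, ← cyclePerm_apply, hπ]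
  · refine (h2 (π c)).symm.trans (Eq.trans ?_ (h2' c))
    change cycleClass g (cyclePerm ρ k) (k (π c)) = cycleClass g (cyclePerm ρ k') (k' c)
    rw [hπ, hσ]

/-- The cell symmetries act simply transitively on the labellings that produce `x`, so every element
occurs with the same multiplicity. -/
theorem card_fiber {ρ : PartFun G} {T : Finset (Fin n)} (hT : T.card = size ρ) {x : GBar G n}
    (hx : x ∈ typeElements ρ T) :
    ((cycleData ρ T).filter fun p => cycleElement ρ p = x).card = Nat.card (cellSymmetries ρ) := by
  obtain ⟨⟨k, g⟩, hp, rfl⟩ := Finset.mem_image.1 hx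
  rw [Nat.card_eq_fintype_card, ← Finset.card_univ]
  symm
  refine Finset.card_bij (fun π _ => (π.1.toEmbedding.trans k, g)) ?_ ?_ ?_
  · rintro ⟨π, hπ⟩ _
    obtain ⟨h1, h2⟩ := comp_cellSymmetry_mem hp hπ
    exact Finset.mem_filter.2 ⟨h2, congrArg (ofWreath g) h1⟩
  · rintro ⟨π, _⟩ _ ⟨π', _⟩ _ h
    apply Subtype.ext
    ext1 c
    exact k.injective (DFunLike.congr_fun (congrArg Prod.fst h) c)
  · rintro ⟨k', g'⟩ hk
    obtain ⟨hk1, he⟩ := Finset.mem_filter.1 hk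
    obtain ⟨hg, hσ⟩ := ofWreath_injective he
    obtain rfl : g' = g := hg
    obtain ⟨π, hπ, hπk⟩ := exists_cellSymmetry hT hp hk1 hσ
    exact ⟨⟨π, hπ⟩, Finset.mem_univ _, Prod.ext hπk rfl⟩

theorem cycleSum_eq (F : Type*) [Field F] {ρ : PartFun G} {T : Finset (Fin n)}
    (hT : T.card = size ρ) :
    cycleSum F ρ T = (Nat.card (cellSymmetries ρ) : F) • reducedCycleSum F ρ T := by
  unfold cycleSum reducedCycleSum
  rw [← Finset.sum_fiberwise_of_maps_to (t := typeElements ρ T) (g := cycleElement ρ)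
    (fun p hp => Finset.mem_image_of_mem _ hp), Finset.smul_sum]
  refine Finset.sum_congr rfl fun x hx => ?_
  rw [Finset.sum_congr rfl (g := fun _ => MonoidAlgebra.single x (1 : F))
    (fun p hp => by rw [(Finset.mem_filter.1 hp).2]), Finset.sum_const, card_fiber hT hx,
    Nat.cast_smul_eq_nsmul]

theorem Delta_eq (F : Type*) [Field F] (n : ℕ) (ρ : PartFun G) :
    Delta F n ρ = (Nat.card (cellSymmetries ρ) : F) • reducedDelta F n ρ := by
  unfold Delta reducedDelta
  rw [Finset.smul_sum]
  refine Finset.sum_congr rfl fun T hT => ?_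
  rw [cycleSum_eq F (Finset.mem_powersetCard.1 hT).2, smul_mul_assoc]

/-- The order divides `‖ρ‖!` by Lagrange, hence `k!`. This is the only place where the
characteristic matters. -/
theorem natCast_card_cellSymmetries_ne_zero {F : Type*} [Field F] {ρ : PartFun G} {k : ℕ}
    (hk : size ρ ≤ k) (h : (k.factorial : F) ≠ 0) : (Nat.card (cellSymmetries ρ) : F) ≠ 0 := by
  obtain ⟨m, hm⟩ := (card_cellSymmetries_dvd ρ).trans (Nat.factorial_dvd_factorial hk)
  rw [hm, Nat.cast_mul] at h
  exact left_ne_zero_of_mul h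

end Multiplicity

/-! ### Functionals dual to the elements `Δ` -/

section Functional

variable (F : Type*) [Field F] {G : Type*} [Group G] {n : ℕ}

/-- The `i`-th column of a matrix. -/
def column (δ : GBar G n) (i : Fin n) : Fin n → WithZero G := fun a => δ.entry a i

/-- The indicator of the condition, void for `i ∉ T`, that a column `v` put in the place of the
`i`-th column `x_i` of `x` satisfies `v_i ≠ 1` if `x_{ii} = 1`, and `v = x_i` otherwise. -/
def columnWeight (x : GBar G n) (T : Finset (Fin n)) (i : Fin n) (v : Fin n → WithZero G) : F :=
  if i ∈ T then (if x.entry i i = 1 then (if v i = 1 then 0 else 1)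
    else if v = column x i then 1 else 0) else 1

/-- The functional counting the matrices whose columns all satisfy the condition of
`columnWeight`. -/
def typeFunctional (x : GBar G n) (T : Finset (Fin n)) : MonoidAlgebra F (GBar G n) →ₗ[F] F :=
  Finsupp.linearCombination F (fun δ : GBar G n => ∏ i, columnWeight F x T i (column δ i)) ∘ₗ
    (MonoidAlgebra.coeffLinearEquiv F).toLinearMap

theorem typeFunctional_apply (x : GBar G n) (T : Finset (Fin n))
    (α : MonoidAlgebra F (GBar G n)) : typeFunctional F x T α =
      α.coeff.sum fun δ a => a * ∏ i, columnWeight F x T i (column δ i) := rfl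

theorem typeFunctional_single (x : GBar G n) (T : Finset (Fin n)) (δ : GBar G n) (r : F) :
    typeFunctional F x T (MonoidAlgebra.single δ r) =
      r * ∏ i, columnWeight F x T i (column δ i) := by
  rw [typeFunctional_apply, MonoidAlgebra.coeff_single, Finsupp.sum_single_index (zero_mul _)]

theorem epsBar_insert {i : Fin n} {U : Finset (Fin n)} (hi : i ∉ U) :
    epsBar F G (insert i U) = (1 - MonoidAlgebra.single (eps i) 1) * epsBar F G U :=
  Finset.noncommProd_insert_of_notMem _ _ _ _ hi

theorem epsBar_empty : epsBar F G (∅ : Finset (Fin n)) = 1 := rfl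

theorem single_mul_epsBar_insert (δ : GBar G n) {i : Fin n} {U : Finset (Fin n)} (hi : i ∉ U) :
    MonoidAlgebra.single δ 1 * epsBar F G (insert i U) =
      MonoidAlgebra.single δ 1 * epsBar F G U -
        MonoidAlgebra.single (δ * eps i) 1 * epsBar F G U := by
  rw [epsBar_insert F hi, ← mul_assoc, mul_sub, mul_one, MonoidAlgebra.single_mul_single, mul_one,
    sub_mul]

/-- Expanding one factor `1 - ε_j` at a time changes only column `j`, so the difference is absorbed
into the `j`-th factor of the product. -/
theorem typeFunctional_mul_epsBar (x : GBar G n) (T U : Finset (Fin n)) (δ : GBar G n) :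
    typeFunctional F x T (MonoidAlgebra.single δ 1 * epsBar F G U) =
      ∏ i, (columnWeight F x T i (column δ i) - if i ∈ U then columnWeight F x T i 0 else 0) := by
  induction U using Finset.induction_on generalizing δ with
  | empty => simp [epsBar_empty, typeFunctional_single]
  | insert j U hj ih =>
    rw [single_mul_epsBar_insert F δ hj, map_sub, ih, ih,
      ← Finset.mul_prod_erase Finset.univ _ (Finset.mem_univ j),
      ← Finset.mul_prod_erase Finset.univ _ (Finset.mem_univ j),
      ← Finset.mul_prod_erase Finset.univ _ (Finset.mem_univ j)]
    have h0 : column (δ * eps j) j = 0 := by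
      funext a; simp [column, mul_eps_entry]
    have h1 : ∀ i ∈ Finset.univ.erase j, column (δ * eps j) i = column δ i := by
      intro i hi
      funext a; simp [column, mul_eps_entry, Finset.ne_of_mem_erase hi]
    rw [Finset.prod_congr rfl (f := fun i => columnWeight F x T i (column (δ * eps j) i) -
        if i ∈ U then columnWeight F x T i 0 else 0)
        (g := fun i => columnWeight F x T i (column δ i) -
        if i ∈ U then columnWeight F x T i 0 else 0) fun i hi => by simp only [h1 i hi],
      Finset.prod_congr rfl (f := fun i => columnWeight F x T i (column δ i) -
        if i ∈ insert j U then columnWeight F x T i 0 else 0)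
        (g := fun i => columnWeight F x T i (column δ i) -
        if i ∈ U then columnWeight F x T i 0 else 0) fun i hi => by
          simp [Finset.ne_of_mem_erase hi]]
    simp only [h0, hj, if_false, sub_zero, Finset.mem_insert_self, if_true]
    ring

theorem column_eq_of_diag {A B : GBar G n} {i : Fin n} (hA : A.entry i i = 1)
    (hB : B.entry i i = 1) : column A i = column B i := by
  have key : ∀ A : GBar G n, A.entry i i = 1 → ∀ a, a ≠ i → A.entry a i = 0 := by
    intro A hA a ha
    by_contra hc
    exact ha (A.col_unique _ _ _ hc (by rw [hA]; exact one_ne_zero))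
  funext a
  by_cases ha : a = i
  · subst ha; exact hA.trans hB.symm
  · exact (key A hA a ha).trans (key B hB a ha).symm

theorem eq_of_column_eq {A B : GBar G n} (h : ∀ i, column A i = column B i) : A = B :=
  GBar.ext (funext fun a => funext fun i => congrFun (h i) a)

/-- The sign `(-1)^m` with `m` the number of fixed points in `T` with entry `1`. -/
def fixedSign (x : GBar G n) (T : Finset (Fin n)) : F :=
  ∏ i, if i ∈ T ∧ x.entry i i = 1 then -1 else 1

theorem fixedSign_ne_zero (x : GBar G n) (T : Finset (Fin n)) : fixedSign F x T ≠ 0 := by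
  refine Finset.prod_ne_zero_iff.2 fun i _ => ?_
  split_ifs <;> simp

theorem column_ofWreath_ne_zero (g : Fin n → G) (σ : Equiv.Perm (Fin n)) (i : Fin n) :
    column (ofWreath g σ) i ≠ 0 := by
  intro h
  have := congrFun h (σ i)
  simp [column, ofWreath_entry] at this

/-- A factor vanishes for each `i ∈ U \ T` (it is `1 - 1`) and each `i ∈ T \ U` (there `y_{ii} =
1`). When `U = T`, the factor at `i ∈ T` is minus the indicator of `y_{ii} = 1` if `x_{ii} = 1`, and
the indicator of equal `i`-th columns otherwise; so all of them are nonzero only for `y = x`. -/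
theorem typeFunctional_orthogonal {x y : GBar G n} {T U : Finset (Fin n)}
    (hx : ∀ i, i ∉ T → x.entry i i = 1) (hx' : ∀ i, column x i ≠ 0)
    (hy : ∀ i, i ∉ U → y.entry i i = 1) :
    typeFunctional F x T (MonoidAlgebra.single y 1 * epsBar F G U) =
      if U = T ∧ y = x then fixedSign F x T else 0 := by
  rw [typeFunctional_mul_epsBar]
  split_ifs with h
  · obtain ⟨rfl, rfl⟩ := h
    unfold fixedSign
    refine Finset.prod_congr rfl fun i _ => ?_
    by_cases hi : i ∈ U
    · by_cases hd : y.entry i i = 1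
      · simp [columnWeight, hi, hd, column]
      · simp [columnWeight, hi, hd, (hx' i).symm]
    · simp [columnWeight, hi]
  · suffices ∃ i, columnWeight F x T i (column y i) =
        if i ∈ U then columnWeight F x T i 0 else 0 by
      obtain ⟨i, hi⟩ := this
      exact Finset.prod_eq_zero (Finset.mem_univ i) (sub_eq_zero.2 hi)
    by_cases hTU : U = T
    · subst hTU
      have hne : y ≠ x := fun hh => h ⟨rfl, hh⟩
      obtain ⟨i, hi⟩ : ∃ i, column y i ≠ column x i := by
        by_contra! hc
        exact hne (eq_of_column_eq hc)
      have hiU : i ∈ U := by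
        by_contra hc
        exact hi (column_eq_of_diag (hy i hc) (hx i hc))
      refine ⟨i, ?_⟩
      by_cases hd : x.entry i i = 1
      · have : y.entry i i ≠ 1 := fun hh => hi (column_eq_of_diag hh hd)
        simp [columnWeight, hiU, hd, column, this]
      · simp [columnWeight, hiU, hd, hi, (hx' i).symm]
    · obtain ⟨i, hi⟩ : ∃ i, ¬ (i ∈ U ↔ i ∈ T) := by
        by_contra! hc
        exact hTU (Finset.ext hc)
      refine ⟨i, ?_⟩
      by_cases hiU : i ∈ U
      · have hiT : i ∉ T := fun hh => hi ⟨fun _ => hh, fun _ => hiU⟩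
        simp [columnWeight, hiU, hiT]
      · have hiT : i ∈ T := by
          by_contra hh
          exact hi ⟨fun h => absurd h hiU, fun h => absurd h hh⟩
        by_cases hd : x.entry i i = 1
        · simp [columnWeight, hiU, hiT, hd, column, hy i hiU]
        · have : column y i ≠ column x i := by
            intro hh
            exact hd ((congrFun hh i).symm.trans (hy i hiU))
          simp [columnWeight, hiU, hiT, hd, this]

theorem columnWeight_eq_zero {x δ : GBar G n} {T : Finset (Fin n)} {i : Fin n} (hi : i ∈ T)
    (hδ : δ.entry i i = 1) : columnWeight F x T i (column δ i) = 0 := by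
  by_cases hd : x.entry i i = 1
  · simp [columnWeight, hi, hd, column, hδ]
  · have : column δ i ≠ column x i := by
      intro hh
      exact hd ((congrFun hh i).symm.trans hδ)
    simp [columnWeight, hi, hd, this]

/-- A matrix of degree less than `|T|` has a diagonal entry `1` at some index of `T`, where its
weight is zero. -/
theorem typeFunctional_of_mem_degFilt (x : GBar G n) {T : Finset (Fin n)} {k : ℕ}
    (hk : k < T.card) {α : MonoidAlgebra F (GBar G n)} (hα : α ∈ degFilt F G n k) :
    typeFunctional F x T α = 0 := by
  have : degFilt F G n k ≤ LinearMap.ker (typeFunctional F x T) := by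
    refine Submodule.span_le.2 ?_
    rintro _ ⟨γ, hγ, rfl⟩
    rw [SetLike.mem_coe, LinearMap.mem_ker, typeFunctional_single, one_mul]
    obtain ⟨i, hi, hi'⟩ : ∃ i ∈ T, γ.entry i i = 1 := by
      by_contra! hc
      exact absurd (Finset.card_le_card (t := Finset.univ.filter fun k => γ.entry k k ≠ 1)
        fun i hi => Finset.mem_filter.2 ⟨Finset.mem_univ _, hc i hi⟩) (by unfold deg at hγ; omega)
    exact Finset.prod_eq_zero (Finset.mem_univ i) (columnWeight_eq_zero F hi hi')
  exact this hα

/-- The weights only test whether diagonal entries are `1` and whether columns agree with those of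
`x`; both tests are equivariant. -/
theorem typeFunctional_conj (x : GBar G n) (T : Finset (Fin n)) (h : Fin n → G)
    (τ : Equiv.Perm (Fin n)) (α : MonoidAlgebra F (GBar G n)) :
    typeFunctional F (wreathConj h τ x) (T.map τ.toEmbedding)
      (MonoidAlgebra.single (wreathUnit h τ : GBar G n) 1 * α *
        MonoidAlgebra.single (↑(wreathUnit h τ)⁻¹ : GBar G n) 1) = typeFunctional F x T α := by
  induction α using MonoidAlgebra.induction_linear with
  | zero => simp
  | add α β hα hβ => rw [mul_add, add_mul, map_add, hα, hβ, map_add]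
  | single δ r =>
    rw [MonoidAlgebra.single_mul_single, MonoidAlgebra.single_mul_single, one_mul, mul_one,
      typeFunctional_single, typeFunctional_single]
    change r * ∏ i, columnWeight F _ _ i (column (wreathConj h τ δ) i) = _
    congr 1
    symm
    refine Fintype.prod_equiv τ _ _ fun i => ?_
    have hdiag : ∀ A : GBar G n,
        (wreathConj h τ A).entry (τ i) (τ i) = 1 ↔ A.entry i i = 1 := by
      intro A
      rw [conj_entry, mul_inv_eq_one₀ WithZero.coe_ne_zero]
      constructor
      · intro hh
        exact mul_left_cancel₀ (WithZero.coe_ne_zero (a := h (τ i))) (hh.trans (mul_one _).symm)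
      · intro hh; rw [hh, mul_one]
    have hcol : column (wreathConj h τ δ) (τ i) =
        column (wreathConj h τ x) (τ i) ↔ column δ i = column x i := by
      simp only [funext_iff, column]
      rw [← τ.forall_congr_right]
      refine forall_congr' fun a => ?_
      rw [conj_entry, conj_entry]
      constructor
      · intro hh
        exact mul_left_cancel₀ WithZero.coe_ne_zero
          (mul_right_cancel₀ (inv_ne_zero WithZero.coe_ne_zero) hh)
      · intro hh; rw [hh]
    have hmem : τ i ∈ T.map τ.toEmbedding ↔ i ∈ T := by simp
    unfold columnWeight
    simp only [hcol, hmem, hdiag]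
    congr 2
    by_cases hd : δ.entry i i = 1
    · simp only [column, (hdiag δ).2 hd, hd, if_true]
    · simp only [column, (hdiag δ).not.2 hd, hd, if_false]

theorem typeFunctional_conj_of_mem_center (x : GBar G n) (T : Finset (Fin n)) (h : Fin n → G)
    (τ : Equiv.Perm (Fin n)) {α : MonoidAlgebra F (GBar G n)}
    (hα : α ∈ Subalgebra.center F (MonoidAlgebra F (GBar G n))) :
    typeFunctional F (wreathConj h τ x) (T.map τ.toEmbedding) α =
      typeFunctional F x T α := by
  conv_rhs => rw [← typeFunctional_conj F x T h τ]
  rw [Subalgebra.mem_center_iff.1 hα, mul_assoc, MonoidAlgebra.single_mul_single, one_mul,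
    Units.mul_inv, ← MonoidAlgebra.one_def, mul_one]

end Functional

/-! ### Separation of central elements -/

section Separation

variable {F : Type*} [Field F] {G : Type*} [Group G] {n : ℕ}

/-- The number of nonzero columns. -/
def rank (δ : GBar G n) : ℕ := (Finset.univ.filter fun i => column δ i ≠ 0).card

theorem rank_le (δ : GBar G n) : rank δ ≤ n :=
  (Finset.card_filter_le _ _).trans (by simp)

/-- A central element has no coefficients at those matrices of maximal degree and rank in its
support which have a zero row and a nonzero column with the same index. -/
theorem exists_row_entry_ne_zero {α : MonoidAlgebra F (GBar G n)}
    (hα : α ∈ Subalgebra.center F (MonoidAlgebra F (GBar G n))) {δ : GBar G n}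
    (hδ : δ ∈ α.coeff.support)
    (hmax : ∀ γ ∈ α.coeff.support, γ.deg = δ.deg → rank γ ≤ rank δ) {j : Fin n}
    (hj : column δ j ≠ 0) : ∃ i, δ.entry j i ≠ 0 := by
  by_contra! hrow
  -- Products ending in `ε_j` have zero `j`-th column. On the other side, the only `γ` in the
  -- support with `ε_j γ = δ` will be `δ` itself, so centrality forces its coefficient to vanish.
  have h1 : (α * MonoidAlgebra.single (eps j) (1 : F)).coeff δ = 0 := by
    apply MonoidAlgebra.coeff_mul_single_of_forall_mul_ne
    intro γ hγ
    apply hj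
    funext a
    rw [← hγ]
    simp [column, mul_eps_entry]
  have h2 : (MonoidAlgebra.single (eps j) (1 : F) * α).coeff δ = 1 * α.coeff δ := by
    apply MonoidAlgebra.coeff_single_mul_eq_mul_coeff
    intro γ hγ
    constructor
    · intro he
      have hle : ∀ a i, a ≠ j → γ.entry a i = δ.entry a i := by
        intro a i ha
        rw [← he, eps_mul_entry, if_neg ha]
      obtain ⟨a, ha⟩ : ∃ a, δ.entry a j ≠ 0 := by
        by_contra! hc
        exact hj (funext hc)
      have haj : a ≠ j := by
        rintro rfl
        exact ha (hrow _)
      -- Column `j` of `γ` already has a nonzero entry off the diagonal; thus restoring row `j`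
      -- leaves the degree unchanged, and any nonzero entry in it would raise the rank.
      have hjj : γ.entry j j = 0 := by
        by_contra hc
        exact haj (γ.col_unique _ _ _ (by rw [hle a j haj]; exact ha) hc)
      have hdeg : γ.deg = δ.deg := by
        unfold deg
        congr 1
        ext i
        simp only [Finset.mem_filter, Finset.mem_univ, true_and]
        by_cases hi : i = j
        · subst hi
          rw [hjj, hrow]
        · rw [hle i i hi]
      have hsub : (Finset.univ.filter fun i => column δ i ≠ 0) ⊆
          Finset.univ.filter fun i => column γ i ≠ 0 := by
        intro i hi
        simp only [Finset.mem_filter, Finset.mem_univ, true_and] at hi ⊢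
        intro hc
        apply hi
        funext b
        by_cases hb : b = j
        · subst hb; exact hrow i
        · exact (hle b i hb).symm.trans (congrFun hc b)
      have heq := Finset.eq_of_subset_of_card_le hsub (hmax γ hγ hdeg)
      apply GBar.ext
      funext b i
      by_cases hb : b = j
      · subst hb
        rw [hrow]
        by_contra hc
        have h3 : i ∈ Finset.univ.filter fun i => column γ i ≠ 0 := by
          simp only [Finset.mem_filter, Finset.mem_univ, true_and]
          exact fun h => hc (congrFun h b)
        rw [← heq] at h3
        simp only [Finset.mem_filter, Finset.mem_univ, true_and] at h3
        obtain ⟨c, hc'⟩ : ∃ c, δ.entry c i ≠ 0 := by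
          by_contra! hc'
          exact h3 (funext hc')
        have hcb : c ≠ b := by
          rintro rfl
          exact hc' (hrow _)
        exact hcb (γ.col_unique _ _ _ (by rw [hle c i hcb]; exact hc') hc)
      · exact hle b i hb
    · rintro rfl
      apply GBar.ext
      funext a i
      rw [eps_mul_entry]
      split_ifs with h
      · rw [h, hrow]
      · rfl
  rw [Subalgebra.mem_center_iff.1 hα, h1, one_mul] at h2
  exact Finsupp.mem_support_iff.1 hδ h2.symm

/-- A matrix in which the rows with the indices of the nonzero columns are nonzero agrees in its
nonzero columns with an element of the wreath product which is the identity in the others. -/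
theorem exists_ofWreath_column_eq {δ : GBar G n}
    (hδ : ∀ j, column δ j ≠ 0 → ∃ i, δ.entry j i ≠ 0) :
    ∃ (g : Fin n → G) (σ : Equiv.Perm (Fin n)),
      (∀ i, column δ i ≠ 0 → column (ofWreath g σ) i = column δ i) ∧
      ∀ i, column δ i = 0 → σ i = i ∧ g i = 1 := by
  have hcol : ∀ a i, δ.entry a i ≠ 0 → column δ i ≠ 0 := fun a i h h' => h (congrFun h' a)
  -- On the indices of nonzero columns, `r j` is the position of the entry in row `j`, again such an
  -- index; elsewhere `r` is the identity. It is thus a permutation, and its inverse is the required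
  -- `σ`.
  have hr : ∀ j, ∃ i, (column δ j ≠ 0 → δ.entry j i ≠ 0) ∧ (column δ j = 0 → i = j) := by
    intro j
    by_cases hj : column δ j = 0
    · exact ⟨j, fun h => absurd hj h, fun _ => rfl⟩
    · obtain ⟨i, hi⟩ := hδ j hj
      exact ⟨i, fun _ => hi, fun h => absurd h hj⟩
  choose r hr1 hr2 using hr
  have hinj : Function.Injective r := by
    intro j j' h
    by_cases hj : column δ j = 0
    · by_cases hj' : column δ j' = 0
      · rw [hr2 j hj, hr2 j' hj'] at h; exact h
      · exact absurd (by rw [← h, hr2 j hj]; exact hj) (hcol _ _ (hr1 j' hj'))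
    · by_cases hj' : column δ j' = 0
      · exact absurd (by rw [h, hr2 j' hj']; exact hj') (hcol _ _ (hr1 j hj))
      · have := hr1 j' hj'
        rw [← h] at this
        exact δ.col_unique _ _ _ (hr1 j hj) this
  let τ : Equiv.Perm (Fin n) := Equiv.ofBijective r (Finite.injective_iff_bijective.1 hinj)
  have hτ : ∀ i, r (τ.symm i) = i := fun i => τ.apply_symm_apply i
  have hg : ∀ j, ∃ a : G, (column δ j ≠ 0 → δ.entry j (r j) = a) ∧ (column δ j = 0 → a = 1) := by
    intro j
    by_cases hj : column δ j = 0
    · exact ⟨1, fun h => absurd hj h, fun _ => rfl⟩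
    · obtain ⟨a, ha⟩ := WithZero.ne_zero_iff_exists.1 (hr1 j hj)
      exact ⟨a, fun _ => ha.symm, fun h => absurd h hj⟩
  choose g hg1 hg2 using hg
  refine ⟨g, τ.symm, fun i hi => ?_, fun i hi => ⟨?_, hg2 i hi⟩⟩
  · have hne : column δ (τ.symm i) ≠ 0 := by
      intro h
      have h1 := hr2 _ h
      rw [hτ] at h1
      rw [← h1] at h
      exact hi h
    funext a
    change (ofWreath g τ.symm).entry a i = δ.entry a i
    rw [ofWreath_entry]
    split_ifs with h
    · subst h
      rw [← hg1 _ hne, hτ]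
    · by_contra hc
      have := hr1 _ hne
      rw [hτ] at this
      exact h (δ.col_unique _ _ _ this (Ne.symm hc))
  · rw [Equiv.symm_apply_eq]
    exact (hr2 i hi).symm

/-- A central element is determined by the values of the functionals attached to the elements of
the wreath product. -/
theorem eq_zero_of_typeFunctional_eq_zero {α : MonoidAlgebra F (GBar G n)}
    (hα : α ∈ Subalgebra.center F (MonoidAlgebra F (GBar G n)))
    (h : ∀ (g : Fin n → G) (σ : Equiv.Perm (Fin n)) (T : Finset (Fin n)),
      (∀ j, j ∉ T → σ j = j ∧ g j = 1) → typeFunctional F (ofWreath g σ) T α = 0) : α = 0 := by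
  by_contra hne
  have hsupp : α.coeff.support.Nonempty := by
    rw [Finsupp.support_nonempty_iff, Ne, MonoidAlgebra.coeff_eq_zero]
    exact hne
  -- The rank is at most `n`, so this number orders pairs (degree, rank) lexicographically.
  obtain ⟨δ, hδ, hmax⟩ := Finset.exists_max_image _ (fun γ => γ.deg * (n + 1) + rank γ) hsupp
  have hdeg : ∀ γ ∈ α.coeff.support, γ.deg ≤ δ.deg := by
    intro γ hγ
    have h1 := hmax γ hγ
    have h2 := rank_le δ
    by_contra! hc
    have : (δ.deg + 1) * (n + 1) ≤ γ.deg * (n + 1) := Nat.mul_le_mul_right _ hc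
    linarith
  have hrank : ∀ γ ∈ α.coeff.support, γ.deg = δ.deg → rank γ ≤ rank δ := by
    intro γ hγ he
    have h1 := hmax γ hγ
    simp only [he] at h1
    omega
  obtain ⟨g, σ, h1, h2⟩ := exists_ofWreath_column_eq fun j hj =>
    exists_row_entry_ne_zero hα hδ hrank hj
  set x := ofWreath g σ with hx
  let T : Finset (Fin n) := Finset.univ.filter fun i => δ.entry i i ≠ 1
  have hT : ∀ i, i ∈ T ↔ δ.entry i i ≠ 1 := fun i => by simp [T]
  have hdiag : ∀ i, column δ i = 0 → x.entry i i = 1 := by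
    intro i hi
    simp [hx, ofWreath_entry, h2 i hi]
  have hcol1 : ∀ i, δ.entry i i = 1 → column δ i ≠ 0 := by
    intro i hi hc
    have h3 : δ.entry i i = 0 := congrFun hc i
    rw [hi] at h3
    exact one_ne_zero h3
  have hdiag' : ∀ i ∈ T, x.entry i i = 1 → column δ i = 0 := by
    intro i hi hxi
    by_contra hc
    exact (hT i).1 hi ((congrFun (h1 i hc) i).symm.trans hxi)
  have hxT : ∀ j, j ∉ T → σ j = j ∧ g j = 1 := by
    intro j hj
    have hj' : δ.entry j j = 1 := by
      by_contra hc
      exact hj ((hT j).2 hc)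
    have h3 : (ofWreath g σ).entry j j = 1 := (congrFun (h1 j (hcol1 j hj')) j).trans hj'
    rw [ofWreath_entry] at h3
    split_ifs at h3 with h4
    · exact ⟨h4, by exact_mod_cast h3⟩
    · exact absurd h3 zero_ne_one
  have h0 := h g σ T hxT
  rw [typeFunctional_apply, Finsupp.sum, Finset.sum_eq_single_of_mem δ hδ] at h0
  · have : ∏ i, columnWeight F (ofWreath g σ) T i (column δ i) = 1 := by
      refine Finset.prod_eq_one fun i _ => ?_
      unfold columnWeight
      by_cases hi : i ∈ T
      · by_cases hd : (ofWreath g σ).entry i i = 1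
        · have h3 : column δ i i ≠ 1 := (hT i).1 hi
          rw [if_pos hi, if_pos hd, if_neg h3]
        · have h3 : column δ i ≠ 0 := fun hc => hd (hdiag i hc)
          rw [if_pos hi, if_neg hd, if_pos (h1 i h3).symm]
      · rw [if_neg hi]
    rw [this, mul_one] at h0
    exact Finsupp.mem_support_iff.1 hδ h0
  · intro γ hγ hγδ
    by_contra hc
    -- Nonzero weights forbid diagonal entries `1` on `T`, so maximal degree makes `T` the whole set
    -- of such indices for `γ`. The nonzero columns of `δ` are then columns of `γ`, and maximal rank
    -- excludes further ones.
    have hw : ∀ i, columnWeight F x T i (column γ i) ≠ 0 := fun i =>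
      (Finset.prod_ne_zero_iff.1 (right_ne_zero_of_mul hc)) i (Finset.mem_univ i)
    have hTγ : T ⊆ Finset.univ.filter fun i => γ.entry i i ≠ 1 := by
      intro i hi
      rw [Finset.mem_filter]
      exact ⟨Finset.mem_univ _, fun hγi => hw i (columnWeight_eq_zero F hi hγi)⟩
    have heq := Finset.eq_of_subset_of_card_le hTγ (hdeg γ hγ)
    have hγdeg : γ.deg = δ.deg := by
      change (Finset.univ.filter fun i => γ.entry i i ≠ 1).card = T.card
      rw [← heq]
    have hγcol : ∀ i, column δ i ≠ 0 → column γ i = column δ i := by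
      intro i hi
      by_cases hiT : i ∈ T
      · have hd : x.entry i i ≠ 1 := fun hd => hi (hdiag' i hiT hd)
        have := hw i
        simp only [columnWeight, hiT, hd, if_true, if_false] at this
        rw [← h1 i hi]
        by_contra hc'
        exact this (if_neg hc')
      · have hγi : γ.entry i i = 1 := by
          rw [heq] at hiT
          by_contra hc'
          exact hiT (by simpa using hc')
        have hδi : δ.entry i i = 1 := by
          by_contra hc'
          exact hiT ((hT i).2 hc')
        exact column_eq_of_diag hγi hδi
    have hsub : (Finset.univ.filter fun i => column δ i ≠ 0) ⊆
        Finset.univ.filter fun i => column γ i ≠ 0 := by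
      intro i hi
      simp only [Finset.mem_filter, Finset.mem_univ, true_and] at hi ⊢
      rwa [hγcol i hi]
    have heq' := Finset.eq_of_subset_of_card_le hsub (hrank γ hγ hγdeg)
    apply hγδ
    apply eq_of_column_eq
    intro i
    by_cases hi : column δ i = 0
    · by_contra hc'
      have : i ∈ Finset.univ.filter fun i => column γ i ≠ 0 := by
        rw [Finset.mem_filter]
        exact ⟨Finset.mem_univ _, by rwa [hi] at hc'⟩
      rw [← heq'] at this
      exact (Finset.mem_filter.1 this).2 hi
    · exact hγcol i hi

end Separation

/-! ### The elements `Δ` are central, of bounded degree, and compatible with the projections -/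

section Central

variable {G : Type*} [Group G] {n : ℕ}

theorem exists_extend_injOn {D : Finset (Fin n)} {r : Fin n → Fin n} (hr : Set.InjOn r D) :
    ∃ τ : Equiv.Perm (Fin n), ∀ i ∈ D, τ i = r i := by
  obtain ⟨g, hg⟩ := Finset.exists_equiv_extend_of_card_eq (t := Finset.univ) (s := D) (f := r)
    (by simp) (Finset.subset_univ _) hr
  exact ⟨g.trans (Equiv.subtypeUnivEquiv fun x => Finset.mem_univ x), fun i hi => hg i hi⟩

/-- The semigroup is generated by the wreath product and the idempotents `ε_i`. -/
theorem gBar_induction {P : GBar G n → Prop} 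
    (unit : ∀ (h : Fin n → G) (τ : Equiv.Perm (Fin n)), P (wreathUnit h τ : GBar G n))
    (mul_eps : ∀ γ i, P γ → P (γ * eps i)) (γ : GBar G n) : P γ := by
  have hr : ∀ i, ∃ j, ∃ a : G, (∃ j', γ.entry i j' ≠ 0) → γ.entry i j = a := by
    intro i
    by_cases h : ∃ j', γ.entry i j' ≠ 0
    · obtain ⟨j, hj⟩ := h
      obtain ⟨a, ha⟩ := WithZero.ne_zero_iff_exists.1 hj
      exact ⟨j, a, fun _ => ha.symm⟩
    · exact ⟨i, 1, fun h' => absurd h' h⟩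
  choose r g hr using hr
  have hinj : Set.InjOn r (Finset.univ.filter fun i => ∃ j', γ.entry i j' ≠ 0 : Finset (Fin n)) := by
    intro i hi i' hi' h
    simp only [Finset.coe_filter, Finset.mem_univ, true_and, Set.mem_ofPred_eq] at hi hi'
    refine γ.col_unique i i' (r i) (by rw [hr i hi]; exact WithZero.coe_ne_zero) ?_
    rw [h, hr i' hi']
    exact WithZero.coe_ne_zero
  -- Complete the partial bijection underlying `γ` to a permutation; the superfluous columns are
  -- removed afterwards by the `ε_k`, one at a time.
  obtain ⟨τ, hτ⟩ := exists_extend_injOn hinj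
  have hprod : ∀ U : Finset (Fin n), ∃ δ : GBar G n, P δ ∧
      ∀ i j, δ.entry i j = if j ∈ U then 0 else (wreathUnit g τ.symm : GBar G n).entry i j := by
    intro U
    induction U using Finset.induction_on with
    | empty => exact ⟨_, unit g τ.symm, by simp⟩
    | insert k U hk ih =>
      obtain ⟨δ, h1, h2⟩ := ih
      refine ⟨δ * eps k, mul_eps _ _ h1, fun i j => ?_⟩
      rw [mul_eps_entry, h2]
      by_cases hj : j = k
      · simp [hj]
      · simp [hj]
  obtain ⟨δ, h1, h2⟩ := hprod (Finset.univ.filter fun j => ∀ i, γ.entry i j = 0)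
  have : γ = δ := by
    apply GBar.ext
    funext i j
    rw [h2, wreathUnit_val, ofWreath_entry]
    simp only [Finset.mem_filter, Finset.mem_univ, true_and]
    split_ifs with h3 h4
    · exact h3 i
    · push Not at h3
      obtain ⟨i', hi'⟩ := h3
      have hi2 := hr i' ⟨j, hi'⟩
      have hj : r i' = j := γ.row_unique i' _ _ (by rw [hi2]; exact WithZero.coe_ne_zero) hi'
      have hτi : τ i' = j := by rw [hτ i' (by simpa using ⟨j, hi'⟩), hj]
      rw [← hτi, Equiv.symm_apply_apply] at h4
      subst h4
      rw [← hi2, hj]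
    · by_contra hc
      have hi2 := hr i ⟨j, hc⟩
      have hj : r i = j := γ.row_unique i _ _ (by rw [hi2]; exact WithZero.coe_ne_zero) hc
      have hτi : τ i = j := by rw [hτ i (by simpa using ⟨j, hc⟩), hj]
      exact h4 (by rw [← hτi, Equiv.symm_apply_apply])
  rw [this]
  exact h1

variable (F : Type*) [Field F]

theorem mem_center_of_commute {z : MonoidAlgebra F (GBar G n)}
    (hunit : ∀ (h : Fin n → G) (τ : Equiv.Perm (Fin n)),
      Commute (MonoidAlgebra.single (wreathUnit h τ : GBar G n) (1 : F)) z)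
    (heps : ∀ i, Commute (MonoidAlgebra.single (eps i : GBar G n) (1 : F)) z) :
    z ∈ Subalgebra.center F (MonoidAlgebra F (GBar G n)) := by
  have key : ∀ γ : GBar G n, Commute (MonoidAlgebra.single γ (1 : F)) z := by
    intro γ
    refine gBar_induction (P := fun γ => Commute (MonoidAlgebra.single γ (1 : F)) z) hunit
      (fun γ i h => ?_) γ
    have : MonoidAlgebra.single (γ * eps i) (1 : F) =
        MonoidAlgebra.single γ 1 * MonoidAlgebra.single (eps i) 1 := by
      rw [MonoidAlgebra.single_mul_single, mul_one]
    rw [this]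
    exact h.mul_left (heps i)
  refine Subalgebra.mem_center_iff.2 fun y => ?_
  induction y using MonoidAlgebra.induction_linear with
  | zero => simp
  | add x y hx hy => rw [add_mul, mul_add, hx, hy]
  | single γ r =>
    have : MonoidAlgebra.single γ r = r • MonoidAlgebra.single γ (1 : F) := by
      rw [MonoidAlgebra.smul_single, smul_eq_mul, mul_one]
    rw [this, smul_mul_assoc, mul_smul_comm, (key γ).eq]

theorem single_eps_commute_epsBar (i : Fin n) (U : Finset (Fin n)) :
    Commute (MonoidAlgebra.single (eps i : GBar G n) (1 : F)) (epsBar F G U) := by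
  induction U using Finset.induction_on with
  | empty => exact Commute.one_right _
  | insert j U hj ih =>
    rw [epsBar_insert F hj]
    refine Commute.mul_right ((Commute.one_right _).sub_right ?_) ih
    exact MonoidAlgebra.single_commute_single (eps_commute i j) (Commute.one_left _)

theorem single_eps_mul_epsBar {i : Fin n} {U : Finset (Fin n)} (hi : i ∈ U) :
    MonoidAlgebra.single (eps i : GBar G n) (1 : F) * epsBar F G U = 0 := by
  rw [← Finset.insert_erase hi, epsBar_insert F (Finset.notMem_erase i U), ← mul_assoc, mul_sub,
    mul_one, MonoidAlgebra.single_mul_single, eps_mul_self, mul_one, sub_self, zero_mul]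

theorem epsBar_mul_single_eps {i : Fin n} {U : Finset (Fin n)} (hi : i ∈ U) :
    epsBar F G U * MonoidAlgebra.single (eps i : GBar G n) (1 : F) = 0 := by
  rw [← (single_eps_commute_epsBar F i U).eq, single_eps_mul_epsBar F hi]

theorem wreathUnit_mul_epsBar (h : Fin n → G) (τ : Equiv.Perm (Fin n)) (U : Finset (Fin n)) :
    MonoidAlgebra.single (wreathUnit h τ : GBar G n) (1 : F) * epsBar F G U =
      epsBar F G (U.map τ.toEmbedding) * MonoidAlgebra.single (wreathUnit h τ : GBar G n) 1 := by
  induction U using Finset.induction_on with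
  | empty => simp [epsBar_empty]
  | insert j U hj ih =>
    have hj' : τ j ∉ U.map τ.toEmbedding := by simpa using hj
    have h1 : (insert j U).map τ.toEmbedding = insert (τ j) (U.map τ.toEmbedding) := by
      rw [Finset.map_insert]; rfl
    rw [h1, epsBar_insert F hj, epsBar_insert F hj', mul_assoc, ← ih, ← mul_assoc, ← mul_assoc,
      mul_sub, sub_mul 1, mul_one, one_mul, MonoidAlgebra.single_mul_single,
      MonoidAlgebra.single_mul_single, wreathUnit_mul_eps]

variable [Fintype G]

theorem reducedDelta_eq_sum (n : ℕ) (ρ : PartFun G) :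
    reducedDelta F n ρ = ∑ T ∈ Finset.univ.powersetCard (size ρ), ∑ x ∈ typeElements ρ T,
      MonoidAlgebra.single x 1 * epsBar F G T := by
  unfold reducedDelta reducedCycleSum
  refine Finset.sum_congr rfl fun T _ => ?_
  rw [Finset.sum_mul]
  rfl

theorem wreathConj_inv_wreathConj (h : Fin n → G) (τ : Equiv.Perm (Fin n)) (A : GBar G n) :
    wreathConj (fun i => (h (τ i))⁻¹) τ⁻¹ (wreathConj h τ A) = A := by
  simp only [wreathConj, ← conj_inv, inv_inv]
  simp [mul_assoc]

theorem wreathConj_wreathConj_inv (h : Fin n → G) (τ : Equiv.Perm (Fin n)) (A : GBar G n) :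
    wreathConj h τ (wreathConj (fun i => (h (τ i))⁻¹) τ⁻¹ A) = A := by
  simp only [wreathConj, ← conj_inv, inv_inv]
  simp [mul_assoc]

theorem map_map_inv (T : Finset (Fin n)) (τ : Equiv.Perm (Fin n)) :
    (T.map τ.toEmbedding).map (τ⁻¹ : Equiv.Perm (Fin n)).toEmbedding = T := by
  change (T.map τ.toEmbedding).map τ.symm.toEmbedding = T
  ext j
  simp

theorem map_inv_map (T : Finset (Fin n)) (τ : Equiv.Perm (Fin n)) :
    (T.map (τ⁻¹ : Equiv.Perm (Fin n)).toEmbedding).map τ.toEmbedding = T := by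
  change (T.map τ.symm.toEmbedding).map τ.toEmbedding = T
  ext j
  simp

theorem single_wreathUnit_commute_reducedDelta (ρ : PartFun G) (h : Fin n → G)
    (τ : Equiv.Perm (Fin n)) :
    Commute (MonoidAlgebra.single (wreathUnit h τ : GBar G n) (1 : F)) (reducedDelta F n ρ) := by
  unfold Commute SemiconjBy
  rw [reducedDelta_eq_sum, Finset.mul_sum, Finset.sum_mul]
  refine Finset.sum_nbij' (fun T => T.map τ.toEmbedding)
    (fun T => T.map (τ⁻¹ : Equiv.Perm (Fin n)).toEmbedding) ?_ ?_
    (fun T _ => map_map_inv T τ) (fun T _ => map_inv_map T τ) ?_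
  · intro T hT
    rw [Finset.mem_powersetCard] at hT ⊢
    exact ⟨Finset.subset_univ _, by rw [Finset.card_map, hT.2]⟩
  · intro T hT
    rw [Finset.mem_powersetCard] at hT ⊢
    exact ⟨Finset.subset_univ _, by rw [Finset.card_map, hT.2]⟩
  · intro T hT
    have hT := (Finset.mem_powersetCard.1 hT).2
    rw [Finset.mul_sum, Finset.sum_mul]
    refine Finset.sum_nbij' (wreathConj h τ) (wreathConj (fun i => (h (τ i))⁻¹) τ⁻¹)
      (fun x hx => conj_mem_typeElements hT hx h τ) (fun x hx => ?_)
      (fun x _ => wreathConj_inv_wreathConj h τ x) (fun x _ => wreathConj_wreathConj_inv h τ x)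
      (fun x _ => ?_)
    · have := conj_mem_typeElements (by rwa [Finset.card_map]) hx (fun i => (h (τ i))⁻¹) τ⁻¹
      rwa [map_map_inv] at this
    · rw [mul_assoc, ← wreathUnit_mul_epsBar, ← mul_assoc, ← mul_assoc,
        MonoidAlgebra.single_mul_single, MonoidAlgebra.single_mul_single]
      congr 2
      simp [wreathConj, mul_assoc]

/-- Conjugation by the wreath product permutes the summands, while each summand separately commutes
with every `ε_i`: both products vanish for `i ∈ T`, and for `i ∉ T` the element fixes `i`. -/
theorem reducedDelta_mem_center (n : ℕ) (ρ : PartFun G) :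
    reducedDelta F n ρ ∈ Subalgebra.center F (MonoidAlgebra F (GBar G n)) := by
  refine mem_center_of_commute F (single_wreathUnit_commute_reducedDelta F ρ) fun i => ?_
  rw [reducedDelta_eq_sum]
  refine Commute.sum_right _ _ _ fun T hT => Commute.sum_right _ _ _ fun x hx => ?_
  have hT := (Finset.mem_powersetCard.1 hT).2
  obtain ⟨g, σ, rfl⟩ := exists_ofWreath_of_mem hx
  have h1 := ((mem_typeElements hT).1 hx).1
  rw [← wreathUnit_val]
  by_cases hi : i ∈ T
  · have hmap : T.map σ.toEmbedding = T := by
      refine (Finset.eq_of_subset_of_card_le (fun j hj => ?_) (by rw [Finset.card_map])).symm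
      refine Finset.mem_map.2 ⟨σ.symm j, ?_, σ.apply_symm_apply j⟩
      by_contra hc
      have h2 := (h1 _ hc).1
      rw [Equiv.apply_symm_apply] at h2
      rw [← h2] at hc
      exact hc hj
    unfold Commute SemiconjBy
    rw [mul_assoc, epsBar_mul_single_eps F hi, mul_zero, wreathUnit_mul_epsBar, hmap, ← mul_assoc,
      single_eps_mul_epsBar F hi, zero_mul]
  · refine Commute.mul_right ?_ (single_eps_commute_epsBar F i T)
    refine MonoidAlgebra.single_commute_single ?_ (Commute.one_left _)
    have := wreathUnit_mul_eps g σ i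
    rw [(h1 i hi).1] at this
    exact this.symm

/-- Multiplying by `ε_j` with `j ∈ T` does not disturb the diagonal entries outside `T`. -/
theorem single_mul_epsBar_mem_degFilt {T : Finset (Fin n)} {δ : GBar G n}
    (hδ : ∀ i, i ∉ T → δ.entry i i = 1) {U : Finset (Fin n)} (hU : U ⊆ T) :
    MonoidAlgebra.single δ 1 * epsBar F G U ∈ degFilt F G n T.card := by
  induction U using Finset.induction_on generalizing δ with
  | empty =>
    rw [epsBar_empty, mul_one]
    refine Submodule.subset_span ⟨δ, Finset.card_le_card fun i hi => ?_, rfl⟩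
    by_contra hc
    exact (Finset.mem_filter.1 hi).2 (hδ i hc)
  | insert j U hj ih =>
    rw [single_mul_epsBar_insert F δ hj]
    rw [Finset.insert_subset_iff] at hU
    refine sub_mem (ih hδ hU.2) (ih (fun i hi => ?_) hU.2)
    rw [mul_eps_entry, if_neg, hδ i hi]
    rintro rfl
    exact hi hU.1

theorem reducedDelta_mem_degFilt (n : ℕ) (ρ : PartFun G) :
    reducedDelta F n ρ ∈ degFilt F G n (size ρ) := by
  rw [reducedDelta_eq_sum]
  refine sum_mem fun T hT => sum_mem fun x hx => ?_
  have hT := (Finset.mem_powersetCard.1 hT).2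
  rw [← hT]
  exact single_mul_epsBar_mem_degFilt F (fun i hi => entry_of_notMem hT hx hi) subset_rfl

theorem theta_single (x : GBar G (n + 1)) (r : F) :
    theta F G n (MonoidAlgebra.single x r) = MonoidAlgebra.single (corner x) r := by
  simp [theta]

theorem theta_single_mul_epsBar_map (x : GBar G (n + 1)) (U : Finset (Fin n)) :
    theta F G n (MonoidAlgebra.single x 1 * epsBar F G (U.map Fin.castSuccEmb)) =
      MonoidAlgebra.single (corner x) 1 * epsBar F G U := by
  induction U using Finset.induction_on generalizing x with
  | empty => simp [epsBar_empty, theta_single]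
  | insert j U hj ih =>
    have hj' : j.castSucc ∉ U.map Fin.castSuccEmb := by simpa using hj
    have h1 : (insert j U).map Fin.castSuccEmb = insert j.castSucc (U.map Fin.castSuccEmb) := by
      rw [Finset.map_insert]; rfl
    rw [h1, single_mul_epsBar_insert F x hj', single_mul_epsBar_insert F _ hj, map_sub, ih, ih]
    congr 3
    apply GBar.ext
    funext a b
    simp [corner, mul_eps_entry]

/-- After embedding by zeros, taking the corner is multiplication on both sides by the last `ε`,
which annihilates `1 - ε`. -/
theorem theta_single_mul_epsBar_of_last_mem (x : GBar G (n + 1)) {U : Finset (Fin (n + 1))}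
    (hU : Fin.last n ∈ U) : theta F G n (MonoidAlgebra.single x 1 * epsBar F G U) = 0 := by
  have hinj : Function.Injective
      (MonoidAlgebra.mapDomainNonUnitalRingHom F (zeroExt : GBar G n →ₙ* GBar G (n + 1))) :=
    MonoidAlgebra.mapDomain_injective zeroExt_injective
  apply hinj
  rw [zeroExt_theta, map_zero, mul_assoc, mul_assoc, epsBar_mul_single_eps F hU, mul_zero,
    mul_zero]

/-- Summands whose `T` contains the last index are killed; on the others the corner map is a
bijection onto the summands one order below. -/
theorem theta_reducedDelta (n : ℕ) (ρ : PartFun G) :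
    theta F G n (reducedDelta F (n + 1) ρ) = reducedDelta F n ρ := by
  rw [reducedDelta_eq_sum, reducedDelta_eq_sum, map_sum]
  have hinj : Function.Injective fun T : Finset (Fin n) => T.map Fin.castSuccEmb :=
    Finset.map_injective _
  have hsub : (Finset.univ.powersetCard (size ρ)).image
      (fun T : Finset (Fin n) => T.map Fin.castSuccEmb) ⊆ Finset.univ.powersetCard (size ρ) := by
    intro T hT
    obtain ⟨T', hT', rfl⟩ := Finset.mem_image.1 hT
    rw [Finset.mem_powersetCard] at hT' ⊢
    exact ⟨Finset.subset_univ _, by rw [Finset.card_map, hT'.2]⟩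
  rw [← Finset.sum_subset hsub, Finset.sum_image fun _ _ _ _ h => hinj h]
  · refine Finset.sum_congr rfl fun T hT => ?_
    have hT := (Finset.mem_powersetCard.1 hT).2
    rw [map_sum]
    refine Finset.sum_nbij corner (fun x hx => corner_mem_typeElements hT hx)
      (fun x hx y hy => corner_injOn hT hx hy) (fun y hy => ?_)
      (fun x _ => theta_single_mul_epsBar_map F x T)
    obtain ⟨x, hx, he⟩ := exists_corner_eq hT hy
    exact ⟨x, hx, he⟩
  · intro T hT hT'
    rw [map_sum]
    refine Finset.sum_eq_zero fun x _ => theta_single_mul_epsBar_of_last_mem F x ?_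
    by_contra hl
    apply hT'
    have he : (Finset.univ.filter fun j : Fin n => j.castSucc ∈ T).map Fin.castSuccEmb = T := by
      ext j
      cases j using Fin.lastCases with
      | last => simp [hl]
      | cast j => simp
    refine Finset.mem_image.2 ⟨_, ?_, he⟩
    rw [Finset.mem_powersetCard] at hT ⊢
    exact ⟨Finset.subset_univ _, by rw [← Finset.card_map Fin.castSuccEmb, he, hT.2]⟩

end Central

/-! ### Bases -/

section Basis

theorem linearIndependent_of_dual {F M ι : Type*} [Field F] [AddCommGroup M] [Module F M]
    {v : ι → M} (φ : ι → M →ₗ[F] F) (h : ∀ i j, φ i (v j) = if j = i then 1 else 0) :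
    LinearIndependent F v := by
  rw [linearIndependent_iff']
  intro s c hc i hi
  have := congrArg (φ i) hc
  simpa [map_sum, h, hi] using this

/-- For spanning, `m - ∑ φ_i(m) v_i` is killed by every functional, hence zero. -/
theorem exists_basis_of_dual {F M ι : Type*} [Field F] [AddCommGroup M] [Module F M] [Finite ι]
    (v : ι → M) (φ : ι → M →ₗ[F] F) (h : ∀ i j, φ i (v j) = if j = i then 1 else 0)
    (hsep : ∀ m, (∀ i, φ i m = 0) → m = 0) : ∃ b : Module.Basis ι F M, ∀ i, b i = v i := by
  have := Fintype.ofFinite ι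
  refine ⟨Module.Basis.mk (linearIndependent_of_dual φ h) fun m _ => ?_,
    fun i => Module.Basis.mk_apply _ _ i⟩
  have hm : m - ∑ i, φ i m • v i = 0 := by
    apply hsep
    intro i
    simp [map_sum, h]
  rw [sub_eq_zero.1 hm]
  exact sum_mem fun i _ => Submodule.smul_mem _ _ (Submodule.subset_span ⟨i, rfl⟩)

theorem exists_basis_smul {F M ι : Type*} [Field F] [AddCommMonoid M] [Module F M]
    {c : ι → F} (hc : ∀ i, c i ≠ 0) (b : Module.Basis ι F M) :
    ∃ b' : Module.Basis ι F M, ∀ i, b' i = c i • b i :=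
  ⟨b.isUnitSMul fun i => (hc i).isUnit, fun i => b.isUnitSMul_apply _ i⟩

variable (F : Type*) [Field F] {G : Type*} [Group G] [Fintype G] {n k : ℕ}

instance finite_partFun_size_le (k : ℕ) : Finite {ρ : PartFun G // size ρ ≤ k} := by
  have hle : ∀ (ρ : PartFun G) C, (ρ C).1 ≤ size ρ := fun ρ C =>
    Finset.single_le_sum (f := fun C => (ρ C).1) (fun _ _ => Nat.zero_le _) (Finset.mem_univ C)
  let f : {ρ : PartFun G // size ρ ≤ k} → ConjClasses G → Σ m : Fin (k + 1), (m : ℕ).Partition :=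
    fun ρ C => ⟨⟨(ρ.1 C).1, Nat.lt_succ_of_le ((hle _ C).trans ρ.2)⟩, (ρ.1 C).2⟩
  refine Finite.of_injective f fun ρ ρ' h => Subtype.ext (funext fun C => ?_)
  exact congrArg (fun p : Σ m : Fin (k + 1), (m : ℕ).Partition =>
    (⟨p.1, p.2⟩ : Σ m : ℕ, m.Partition)) (congrFun h C)

theorem typeFunctional_reducedDelta {ρ : PartFun G} {T : Finset (Fin n)} (hT : T.card = size ρ)
    {x : GBar G n} (hx : x ∈ typeElements ρ T) (ρ' : PartFun G) :
    typeFunctional F x T (reducedDelta F n ρ') = if ρ' = ρ then fixedSign F x T else 0 := by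
  obtain ⟨g, σ, hgσ⟩ := exists_ofWreath_of_mem hx
  have horth : ∀ U ∈ Finset.univ.powersetCard (size ρ'), ∀ y ∈ typeElements ρ' U,
      typeFunctional F x T (MonoidAlgebra.single y 1 * epsBar F G U) =
        if U = T ∧ y = x then fixedSign F x T else 0 := by
    intro U hU y hy
    have hU := (Finset.mem_powersetCard.1 hU).2
    exact typeFunctional_orthogonal F (fun i hi => entry_of_notMem hT hx hi)
      (fun i => by rw [hgσ]; exact column_ofWreath_ne_zero g σ i)
      (fun i hi => entry_of_notMem hU hy hi)
  rw [reducedDelta_eq_sum, map_sum, Finset.sum_congr rfl (g := fun U =>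
    ∑ y ∈ typeElements ρ' U, if U = T ∧ y = x then fixedSign F x T else 0) fun U hU => by
      rw [map_sum]; exact Finset.sum_congr rfl (horth U hU)]
  split_ifs with h
  · subst h
    rw [Finset.sum_eq_single_of_mem T (Finset.mem_powersetCard.2 ⟨Finset.subset_univ _, hT⟩),
      Finset.sum_eq_single_of_mem x hx]
    · simp
    · intro y _ hy; simp [hy]
    · intro U _ hU; simp [hU]
  · refine Finset.sum_eq_zero fun U hU => Finset.sum_eq_zero fun y hy => if_neg ?_
    rintro ⟨rfl, rfl⟩
    exact h (type_unique (Finset.mem_powersetCard.1 hU).2 hT hy hx)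

/-- One pair `(x, T)` of type `ρ` is chosen and the sign divided out. On central elements
conjugation invariance lets this single functional stand for all pairs of type `ρ`. -/
theorem exists_dual (ρ : PartFun G) (h : size ρ ≤ n) :
    ∃ φ : MonoidAlgebra F (GBar G n) →ₗ[F] F,
      (∀ ρ', φ (reducedDelta F n ρ') = if ρ' = ρ then 1 else 0) ∧
      (∀ k, k < size ρ → ∀ α ∈ degFilt F G n k, φ α = 0) ∧
      ∀ α ∈ Subalgebra.center F (MonoidAlgebra F (GBar G n)), φ α = 0 →
        ∀ T x, T.card = size ρ → x ∈ typeElements ρ T → typeFunctional F x T α = 0 := by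
  obtain ⟨T, _, hT⟩ := Finset.exists_subset_card_eq (s := (Finset.univ : Finset (Fin n)))
    (n := size ρ) (by simpa using h)
  obtain ⟨x, hx⟩ := typeElements_nonempty hT
  have hs := fixedSign_ne_zero F x T
  refine ⟨(fixedSign F x T)⁻¹ • typeFunctional F x T, fun ρ' => ?_, fun k hk α hα => ?_,
    fun α hα hφ T' x' hT' hx' => ?_⟩
  · rw [LinearMap.smul_apply, typeFunctional_reducedDelta F hT hx, smul_eq_mul]
    split_ifs
    · exact inv_mul_cancel₀ hs
    · exact mul_zero _
  · rw [LinearMap.smul_apply, typeFunctional_of_mem_degFilt F x (hT.symm ▸ hk) hα, smul_zero]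
  · rw [LinearMap.smul_apply, smul_eq_zero] at hφ
    obtain ⟨w, τ, rfl, rfl⟩ := exists_conj_of_mem_typeElements hT hT' hx hx'
    rw [typeFunctional_conj_of_mem_center F x T w τ hα]
    exact hφ.resolve_left (inv_ne_zero hs)

/-- The coordinate functionals of the center with respect to the elements `reducedDelta`. -/
def dual (ρ : PartFun G) (h : size ρ ≤ n) : MonoidAlgebra F (GBar G n) →ₗ[F] F :=
  (exists_dual F ρ h).choose

theorem dual_reducedDelta (ρ : PartFun G) (h : size ρ ≤ n) (ρ' : PartFun G) :
    dual F ρ h (reducedDelta F n ρ') = if ρ' = ρ then 1 else 0 :=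
  (exists_dual F ρ h).choose_spec.1 ρ'

theorem dual_of_mem_degFilt {ρ : PartFun G} (h : size ρ ≤ n) (hk : k < size ρ)
    {α : MonoidAlgebra F (GBar G n)} (hα : α ∈ degFilt F G n k) : dual F ρ h α = 0 :=
  (exists_dual F ρ h).choose_spec.2.1 k hk α hα

theorem eq_zero_of_dual {α : MonoidAlgebra F (GBar G n)}
    (hα : α ∈ Subalgebra.center F (MonoidAlgebra F (GBar G n)))
    (h : ∀ (ρ : PartFun G) (hρ : size ρ ≤ n), dual F ρ hρ α = 0) : α = 0 := by
  refine eq_zero_of_typeFunctional_eq_zero hα fun g σ T hT => ?_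
  obtain ⟨ρ, hTρ, hx⟩ := exists_mem_typeElements hT
  have hρ : size ρ ≤ n := by
    rw [← hTρ]
    exact (Finset.card_le_univ T).trans (by simp)
  exact (exists_dual F ρ hρ).choose_spec.2.2 α hα (h ρ hρ) T _ hTρ hx

theorem exists_basis_center (n : ℕ) :
    ∃ b : Module.Basis {ρ : PartFun G // size ρ ≤ n} F
      (Subalgebra.center F (MonoidAlgebra F (GBar G n))),
      ∀ ρ, (b ρ).1 = reducedDelta F n ρ := by
  obtain ⟨b, hb⟩ := exists_basis_of_dual (F := F)
    (fun ρ : {ρ : PartFun G // size ρ ≤ n} =>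
      (⟨reducedDelta F n ρ.1, reducedDelta_mem_center F n ρ.1⟩ :
        Subalgebra.center F (MonoidAlgebra F (GBar G n))))
    (fun ρ => (dual F ρ.1 ρ.2).comp
      (Subalgebra.center F (MonoidAlgebra F (GBar G n))).val.toLinearMap)
    (fun ρ ρ' => by
      refine (dual_reducedDelta F ρ.1 ρ.2 ρ'.1).trans ?_
      simp only [Subtype.ext_iff])
    (fun m hm => Subtype.ext (eq_zero_of_dual F m.2 fun ρ hρ => hm ⟨ρ, hρ⟩))
  exact ⟨b, fun ρ => congrArg Subtype.val (hb ρ)⟩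

/-- The functionals with `‖ρ‖ > k` vanish on this subspace, so the remaining ones still separate its
points. -/
theorem exists_basis_centerFilt (h : k ≤ n) :
    ∃ b : Module.Basis {ρ : PartFun G // size ρ ≤ k} F (centerFilt F G n k),
      ∀ ρ, (b ρ).1 = reducedDelta F n ρ := by
  obtain ⟨b, hb⟩ := exists_basis_of_dual (F := F)
    (fun ρ : {ρ : PartFun G // size ρ ≤ k} =>
      (⟨reducedDelta F n ρ.1, reducedDelta_mem_center F n ρ.1,
        degFilt_mono F G ρ.2 (reducedDelta_mem_degFilt F n ρ.1)⟩ : centerFilt F G n k))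
    (fun ρ => (dual F ρ.1 (ρ.2.trans h)).comp (centerFilt F G n k).subtype)
    (fun ρ ρ' => by
      refine (dual_reducedDelta F ρ.1 (ρ.2.trans h) ρ'.1).trans ?_
      simp only [Subtype.ext_iff])
    (fun m hm => Subtype.ext (eq_zero_of_dual F m.2.1 fun ρ hρ => by
      by_cases hk : size ρ ≤ k
      · exact hm ⟨ρ, hk⟩
      · exact dual_of_mem_degFilt F hρ (not_le.1 hk) m.2.2))
  exact ⟨b, fun ρ => congrArg Subtype.val (hb ρ)⟩

/-- On central elements of degree at most `k`, the coordinates of `α` and of its projection agree,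
as can be checked on the basis. -/
theorem eq_zero_of_theta_eq_zero (h : k ≤ n) {α : MonoidAlgebra F (GBar G (n + 1))}
    (hα : α ∈ centerFilt F G (n + 1) k) (hθ : theta F G n α = 0) : α = 0 := by
  refine eq_zero_of_dual F hα.1 fun ρ hρ => ?_
  by_cases hk : size ρ ≤ k
  · obtain ⟨b, hb⟩ := exists_basis_centerFilt F (G := G) (h.trans n.le_succ)
    have : (dual F ρ hρ).comp (centerFilt F G (n + 1) k).subtype =
        ((dual F ρ (hk.trans h)).comp (theta F G n)).comp (centerFilt F G (n + 1) k).subtype := by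
      refine b.ext fun ρ' => ?_
      simp only [LinearMap.comp_apply, Submodule.subtype_apply]
      rw [hb, theta_reducedDelta, dual_reducedDelta, dual_reducedDelta]
    have h1 := LinearMap.congr_fun this ⟨α, hα⟩
    simp only [LinearMap.comp_apply, Submodule.subtype_apply, hθ, map_zero] at h1
    exact h1
  · exact dual_of_mem_degFilt F hρ (not_le.1 hk) hα.2

/-- The element `(reducedDelta n ρ)_n` of the limit algebra. -/
def limitDelta (ρ : PartFun G) : limitAlgebra F G :=
  ⟨fun n => reducedDelta F n ρ, fun n => reducedDelta_mem_center F n ρ,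
    fun n => theta_reducedDelta F n ρ, size ρ, fun n => reducedDelta_mem_degFilt F n ρ⟩

theorem limitDelta_mem_limitFilt {ρ : PartFun G} (h : size ρ ≤ k) :
    limitDelta F ρ ∈ limitFilt F G k :=
  fun n => degFilt_mono F G h (reducedDelta_mem_degFilt F n ρ)

/-- Vanishing at level `k` spreads upwards by injectivity of the projections and downwards by
applying them. -/
theorem eq_zero_of_limitFilt {α : limitAlgebra F G} (hα : α ∈ limitFilt F G k)
    (hk : α.1 k = 0) : α = 0 := by
  apply Subtype.ext
  funext n
  rcases le_total k n with h | h
  · induction n, h using Nat.le_induction with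
    | base => exact hk
    | succ n h ih =>
      exact eq_zero_of_theta_eq_zero F h ⟨α.2.1 (n + 1), hα (n + 1)⟩ ((α.2.2.1 n).trans ih)
  · induction h using Nat.decreasingInduction with
    | self => exact hk
    | of_succ n h ih => exact (α.2.2.1 n).symm.trans (by rw [ih]; exact map_zero _)

/-- The `k`-th component of an element of the limit algebra. -/
def limitProj (k : ℕ) : limitAlgebra F G →ₗ[F] MonoidAlgebra F (GBar G k) :=
  (LinearMap.proj k).comp (limitAlgebra F G).val.toLinearMap

theorem exists_basis_limitFilt (k : ℕ) :
    ∃ b : Module.Basis {ρ : PartFun G // size ρ ≤ k} F (limitFilt F G k),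
      ∀ ρ, (b ρ).1 = limitDelta F ρ.1 := by
  obtain ⟨b, hb⟩ := exists_basis_of_dual (F := F)
    (fun ρ : {ρ : PartFun G // size ρ ≤ k} =>
      (⟨limitDelta F ρ.1, limitDelta_mem_limitFilt F ρ.2⟩ : limitFilt F G k))
    (fun ρ => ((dual F ρ.1 ρ.2).comp (limitProj F k)).comp (limitFilt F G k).subtype)
    (fun ρ ρ' => by
      refine (dual_reducedDelta F ρ.1 ρ.2 ρ'.1).trans ?_
      simp only [Subtype.ext_iff])
    (fun m hm => Subtype.ext (eq_zero_of_limitFilt F m.2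
      (eq_zero_of_dual F (m.1.2.1 k) fun ρ hρ => hm ⟨ρ, hρ⟩)))
  exact ⟨b, fun ρ => congrArg Subtype.val (hb ρ)⟩

/-- The functional for `ρ` is evaluated at level `‖ρ‖`, the first where it is defined. Spanning
reduces to the filtration terms because every element has bounded degree. -/
theorem exists_basis_limitAlgebra :
    ∃ b : Module.Basis (PartFun G) F (limitAlgebra F G), ∀ ρ, b ρ = limitDelta F ρ := by
  have hli : LinearIndependent F (limitDelta F (G := G)) :=
    linearIndependent_of_dual (fun ρ => (dual F ρ le_rfl).comp (limitProj F (size ρ)))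
      fun ρ ρ' => (dual_reducedDelta F ρ le_rfl ρ').trans (by congr)
  refine ⟨Module.Basis.mk hli fun α _ => ?_, fun ρ => Module.Basis.mk_apply _ _ ρ⟩
  obtain ⟨k, hk⟩ := α.2.2.2
  obtain ⟨b, hb⟩ := exists_basis_limitFilt F (G := G) k
  have := Fintype.ofFinite {ρ : PartFun G // size ρ ≤ k}
  have h1 := congrArg Subtype.val (b.sum_repr ⟨α, hk⟩)
  rw [AddSubmonoidClass.coe_finsetSum] at h1
  change _ = α at h1
  rw [← h1]
  refine sum_mem fun ρ _ => ?_
  rw [Submodule.coe_smul, hb]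
  exact Submodule.smul_mem _ _ (Submodule.subset_span ⟨ρ.1, rfl⟩)

end Basis

end WreathLimit

end

theorem mainTheorem3 (F : Type*) [Field F] (G : Type*) [Group G] [Fintype G] :
    -- the elements `Δ` themselves, in characteristic zero (in characteristic larger than `k`
    -- for the statements that involve only `‖ρ‖ ≤ k`)
    ((CharZero F → ∃ b : Module.Basis (WreathLimit.PartFun G) F (WreathLimit.limitAlgebra F G),
        ∀ ρ n, (b ρ).1 n = WreathLimit.Delta F n ρ) ∧
      (∀ k : ℕ, (k.factorial : F) ≠ 0 →
        ∃ b : Module.Basis {ρ : WreathLimit.PartFun G // WreathLimit.size ρ ≤ k} F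
          (WreathLimit.limitFilt F G k),
        ∀ ρ n, (b ρ).1.1 n = WreathLimit.Delta F n ρ) ∧
      (∀ n : ℕ, (n.factorial : F) ≠ 0 →
        ∃ b : Module.Basis {ρ : WreathLimit.PartFun G // WreathLimit.size ρ ≤ n} F
          (Subalgebra.center F (MonoidAlgebra F (WreathLimit.GBar G n))),
        ∀ ρ, (b ρ).1 = WreathLimit.Delta F n ρ) ∧
      (∀ n k : ℕ, k ≤ n → (k.factorial : F) ≠ 0 →
        ∃ b : Module.Basis {ρ : WreathLimit.PartFun G // WreathLimit.size ρ ≤ k} F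
          (WreathLimit.centerFilt F G n k),
        ∀ ρ, (b ρ).1 = WreathLimit.Delta F n ρ)) ∧
    -- over an arbitrary field, the same with the multiplicity-free elements
    ((∃ b : Module.Basis (WreathLimit.PartFun G) F (WreathLimit.limitAlgebra F G),
        ∀ ρ n, (b ρ).1 n = WreathLimit.reducedDelta F n ρ) ∧
      (∀ k : ℕ, ∃ b : Module.Basis {ρ : WreathLimit.PartFun G // WreathLimit.size ρ ≤ k} F
          (WreathLimit.limitFilt F G k),
        ∀ ρ n, (b ρ).1.1 n = WreathLimit.reducedDelta F n ρ) ∧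
      (∀ n : ℕ, ∃ b : Module.Basis {ρ : WreathLimit.PartFun G // WreathLimit.size ρ ≤ n} F
          (Subalgebra.center F (MonoidAlgebra F (WreathLimit.GBar G n))),
        ∀ ρ, (b ρ).1 = WreathLimit.reducedDelta F n ρ) ∧
      (∀ n k : ℕ, k ≤ n →
        ∃ b : Module.Basis {ρ : WreathLimit.PartFun G // WreathLimit.size ρ ≤ k} F
          (WreathLimit.centerFilt F G n k),
        ∀ ρ, (b ρ).1 = WreathLimit.reducedDelta F n ρ)) := by
  refine ⟨⟨fun _ => ?_, fun k hk => ?_, fun n hn => ?_, fun n k h hk => ?_⟩, ?_, fun k => ?_,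
    WreathLimit.exists_basis_center F, fun n k h => WreathLimit.exists_basis_centerFilt F h⟩
  · obtain ⟨b, hb⟩ := WreathLimit.exists_basis_limitAlgebra F (G := G)
    -- No single `k` bounds all `ρ`, so each scalar is handled with `k = ‖ρ‖`, whose factorial is
    -- nonzero in characteristic zero.
    obtain ⟨b', hb'⟩ := WreathLimit.exists_basis_smul (fun ρ => WreathLimit.natCast_card_cellSymmetries_ne_zero
      (F := F) (le_refl (WreathLimit.size ρ)) (Nat.cast_ne_zero.2 (Nat.factorial_ne_zero _))) b
    refine ⟨b', fun ρ n => ?_⟩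
    rw [hb', hb, WreathLimit.Delta_eq]
    rfl
  · obtain ⟨b, hb⟩ := WreathLimit.exists_basis_limitFilt F (G := G) k
    obtain ⟨b', hb'⟩ := WreathLimit.exists_basis_smul
      (fun ρ : {ρ : WreathLimit.PartFun G // WreathLimit.size ρ ≤ k} => WreathLimit.natCast_card_cellSymmetries_ne_zero ρ.2 hk) b
    refine ⟨b', fun ρ n => ?_⟩
    rw [hb', Submodule.coe_smul, hb, WreathLimit.Delta_eq]
    rfl
  · obtain ⟨b, hb⟩ := WreathLimit.exists_basis_center F (G := G) n
    obtain ⟨b', hb'⟩ := WreathLimit.exists_basis_smul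
      (fun ρ : {ρ : WreathLimit.PartFun G // WreathLimit.size ρ ≤ n} => WreathLimit.natCast_card_cellSymmetries_ne_zero ρ.2 hn) b
    refine ⟨b', fun ρ => ?_⟩
    rw [hb', WreathLimit.Delta_eq, ← hb]
    rfl
  · obtain ⟨b, hb⟩ := WreathLimit.exists_basis_centerFilt F (G := G) h
    obtain ⟨b', hb'⟩ := WreathLimit.exists_basis_smul
      (fun ρ : {ρ : WreathLimit.PartFun G // WreathLimit.size ρ ≤ k} => WreathLimit.natCast_card_cellSymmetries_ne_zero ρ.2 hk) b
    refine ⟨b', fun ρ => ?_⟩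
    rw [hb', WreathLimit.Delta_eq, ← hb]
    rfl
  · obtain ⟨b, hb⟩ := WreathLimit.exists_basis_limitAlgebra F (G := G)
    exact ⟨b, fun ρ n => by rw [hb]; rfl⟩
  · obtain ⟨b, hb⟩ := WreathLimit.exists_basis_limitFilt F (G := G) k
    exact ⟨b, fun ρ n => by rw [hb]; rfl⟩
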